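/- Let $d\ge 0$ be an integer, $\mathbb{T}^d=(\mathbb{R}/\mathbb{Z})^d$, and let $\mathcal{P}(\mathbb{T}^d)$ be the space of Borel probability measures on $\mathbb{T}^d$, equipped with the $\mathcal{W}_1$-Wasserstein distance (equivalently, with the topology of weak convergence). A function $\Phi:\mathcal{P}(\mathbb{T}^d)\to\mathbb{R}$ is $k$ times differentiable with respect to the measure argument if there are jointly continuous functions $\frac{\delta^\ell\Phi}{\delta m^\ell}:\mathcal{P}(\mathbb{T}^d)\times(\mathbb{T}^d)^\ell\to\mathbb{R}$, $0\le \ell\le k$, with $\frac{\delta^0\Phi}{\delta m^0}=\Phi$, such that for all $0\le \ell<k$, $m,m'\in\mathcal{P}(\mathbb{T}^d)$ and $y\in(\mathbb{T}^d)^\ell$, $$\frac{\delta^\ell\Phi}{\delta m^\ell}(m',y)-\frac{\delta^\ell\Phi}{\delta m^\ell}(m,y)=\int_0^1\int_{\mathbb{T}^d}\frac{\delta^{\ell+1}\Phi}{\delta m^{\ell+1}}\big((1-s)m+sm',y,y'\big)\,(m'-m)(\mathrm{d}y')\,\mathrm{d}s,\qquad \int_{\mathbb{T}^d}\frac{\delta^{\ell+1}\Phi}{\delta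 m^{\ell+1}}(m,y,y')\,m(\mathrm{d}y')=0 .$$ For a real $s\ge 0$ and an integer $k\ge 0$, put $n=\lfloor s\rfloor$ and $a=s-n\in[0,1)$. The function $\Phi$ satisfies $(\mathrm{Int}\text{-}\Phi\text{-}(s,k))$ if it is $k$ times differentiable with respect to $m$ and, for every $\ell\in\{0,\dots,k\}$ and all $n_1,\dots,n_\ell\in\{0,\dots,n\}$, the crossed derivatives $\partial_{y_1}^{n_1}\cdots\partial_{y_\ell}^{n_\ell}\frac{\delta^\ell\Phi}{\delta m^\ell}(m,y_1,\dots,y_\ell)$ exist, are continuous in $(y_1,\dots,y_\ell)$ and are, uniformly in $m$, bounded, continuous and, if $a>0$, $a$-Hölder continuous in $(y_1,\dots,y_\ell)$. The suprema and (if $a>0$) the Hölder constants of these derivatives, taken uniformly in $m$, are called the bounds of $\Phi$ in $(\mathrm{Int}\text{-}\Phi\text{-}(s,k))$. The function $\Phi$ is called smooth if it satisfies $(\mathrm{Int}\text{-}\Phi\text{-}(n,k))$ for all integers $n,k\ge 0$. **Theorem.** Let $\alpha\in[0,1)$ and let $\Phi:\mathcal{P}(\mathbb{T}^d)\to\mathbb{R}$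 satisfy $(\mathrm{Int}\text{-}\Phi\text{-}(\alpha,2))$. Then there exists a sequence of smooth functions $\Phi_n:\mathcal{P}(\mathbb{T}^d)\to\mathbb{R}$, each of which satisfies $(\mathrm{Int}\text{-}\Phi\text{-}(4,3))$, such that $\Phi_n$ converges to $\Phi$ uniformly on $\mathcal{P}(\mathbb{T}^d)$ and the bounds of the $\Phi_n$ in $(\mathrm{Int}\text{-}\Phi\text{-}(\alpha,2))$ are uniform in $n$: a single constant $C$ (independent of $n$) dominates all of them. -/

import Mathlib

open MeasureTheory Filter Topology

/-- The `d`-dimensional torus `(ℝ / ℤ)^d`. -/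
abbrev Torus (d : ℕ) : Type := UnitAddTorus (Fin d)

/-- The space of Borel probability measures on the torus. Mathlib equips it with the topology of
weak convergence, which (the torus being compact) is the topology of the Wasserstein distance
`W₁`. -/
abbrev ProbTorus (d : ℕ) : Type := ProbabilityMeasure (Torus d)

/-- The convex combination `(1 - s) m + s m'` of two probability measures, `s ∈ [0, 1]`. -/
noncomputable def mixture {d : ℕ} (s : unitInterval) (m m' : ProbTorus d) : ProbTorus d :=
  ⟨ENNReal.ofReal (1 - s) • (m : Measure (Torus d)) + ENNReal.ofReal s • (m' : Measure (Torus d)),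
    ⟨by
      have h0 : (0 : ℝ) ≤ s := s.2.1
      have h1 : (0 : ℝ) ≤ 1 - s := sub_nonneg.2 s.2.2
      simp only [Measure.add_apply, Measure.smul_apply, measure_univ, smul_eq_mul, mul_one]
      rw [← ENNReal.ofReal_add h1 h0]
      simp⟩⟩

/-- `V ℓ`, for `ℓ ≤ k`, is the `ℓ`-th order linear functional (flat) derivative
`δ^ℓ Φ / δ m^ℓ : P(𝕋^d) × (𝕋^d)^ℓ → ℝ` of `Φ`: the derivatives are jointly continuous, each one is
obtained from the previous one by the defining identity
`V ℓ m' y - V ℓ m y = ∫₀¹ ∫ V (ℓ+1) ((1-s) m + s m') (y, y') (m' - m)(dy') ds`,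
the new variable being the last one, and each is normalised to have zero `m`-mean in its last
variable (this makes the derivatives unique). -/
structure IsFlatDeriv {d : ℕ} (k : ℕ) (Φ : ProbTorus d → ℝ)
    (V : (ℓ : ℕ) → ProbTorus d → (Fin ℓ → Torus d) → ℝ) : Prop where
  zero : ∀ m y, V 0 m y = Φ m
  continuous : ∀ ℓ ≤ k, Continuous fun p : ProbTorus d × (Fin ℓ → Torus d) => V ℓ p.1 p.2
  sub_eq_integral : ∀ ℓ < k, ∀ (m m' : ProbTorus d) (y : Fin ℓ → Torus d),
    V ℓ m' y - V ℓ m y =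
      ∫ s : unitInterval,
        ((∫ y', V (ℓ + 1) (mixture s m m') (Fin.snoc y y') ∂(m' : Measure (Torus d))) -
          ∫ y', V (ℓ + 1) (mixture s m m') (Fin.snoc y y') ∂(m : Measure (Torus d)))
  integral_eq_zero : ∀ ℓ < k, ∀ (m : ProbTorus d) (y : Fin ℓ → Torus d),
    ∫ y', V (ℓ + 1) m (Fin.snoc y y') ∂(m : Measure (Torus d)) = 0

/-- A tuple `β = (β_1, …, β_ℓ)` of multi-indices of `ℕ^d` is admissible at level `n` if each block
satisfies `|β_i| ≤ n`; it encodes a component of `∂_{y_1}^{n_1} ⋯ ∂_{y_ℓ}^{n_ℓ}` with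
`n_i = |β_i| ∈ {0, …, n}`. -/
def Admissible {d ℓ : ℕ} (n : ℕ) (β : Fin ℓ → Fin d → ℕ) : Prop :=
  ∀ i, ∑ j, β i j ≤ n

/-- `D β`, for `β` admissible at level `n`, are the crossed partial derivatives of
`f : (𝕋^d)^ℓ → ℝ`, and they are all continuous. The derivative in the `j`-th coordinate of the
`i`-th variable is the derivative at `t = 0` along `t ↦ y + t e_{i,j}`, `t` being taken modulo 1. -/
structure IsCrossedDeriv {d ℓ : ℕ} (n : ℕ) (f : (Fin ℓ → Torus d) → ℝ)
    (D : (Fin ℓ → Fin d → ℕ) → (Fin ℓ → Torus d) → ℝ) : Prop where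
  zero : D 0 = f
  continuous : ∀ β, Admissible n β → Continuous (D β)
  hasDerivAt : ∀ (β : Fin ℓ → Fin d → ℕ) (i : Fin ℓ) (j : Fin d),
    Admissible n (β + Pi.single i (Pi.single j 1)) → ∀ y : Fin ℓ → Torus d,
      HasDerivAt (fun t : ℝ => D β (y + Pi.single i (Pi.single j (t : UnitAddCircle))))
        (D (β + Pi.single i (Pi.single j 1)) y) 0

/-- `Φ` satisfies Int-`Φ`-`(s, k)` with all the bounds in it being at most `C`. Here `n = ⌊s⌋` and
`a = s - n`. The function `Φ` is `k` times differentiable in the measure argument, and for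
`ℓ ≤ k` the crossed derivatives of `δ^ℓ Φ / δ m^ℓ` in the variables `y_1, …, y_ℓ`, up to order `n`
in each of them, exist, are continuous and, uniformly in `m`, are bounded by `C`,
(equi)continuous and, if `a > 0`, `a`-Hölder with constant `C`. The distance on `(𝕋^d)^ℓ` is the
maximum of the coordinate distances, which is equivalent to the Euclidean one. -/
def IntPhiBound {d : ℕ} (s : ℝ) (k : ℕ) (C : ℝ) (Φ : ProbTorus d → ℝ) : Prop :=
  ∃ V : (ℓ : ℕ) → ProbTorus d → (Fin ℓ → Torus d) → ℝ, IsFlatDeriv k Φ V ∧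
    ∀ ℓ ≤ k, ∃ D : (Fin ℓ → Fin d → ℕ) → ProbTorus d → (Fin ℓ → Torus d) → ℝ,
      (∀ m, IsCrossedDeriv ⌊s⌋₊ (V ℓ m) fun β => D β m) ∧
      ∀ β, Admissible ⌊s⌋₊ β →
        (∀ m y, |D β m y| ≤ C) ∧
        UniformEquicontinuous (D β) ∧
        (0 < s - ⌊s⌋₊ → ∀ m y z, |D β m y - D β m z| ≤ C * dist y z ^ (s - ⌊s⌋₊))

/-- The condition Int-`Φ`-`(s, k)`. -/
def IntPhi {d : ℕ} (s : ℝ) (k : ℕ) (Φ : ProbTorus d → ℝ) : Prop :=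
  ∃ C : ℝ, IntPhiBound s k C Φ

/-- A smooth functional on `P(𝕋^d)`: it has flat derivatives of every order in `m`, and each of them
has bounded continuous crossed derivatives of every order in the space variables. -/
def SmoothFunctional {d : ℕ} (Φ : ProbTorus d → ℝ) : Prop :=
  ∀ n k : ℕ, IntPhi (n : ℝ) k Φ

/-! The approximation is probabilistic. With `N = n + 1`, let `X_i` be independent with law `m`, let
`Z_i` be independent with a density `ρ_n` concentrating at the origin, and set `Φ_n(m) = E Φ(N⁻¹ ∑
δ_{X_i + Z_i})`. Equivalently, `Φ_n(m) = ∫ H dm^{⊗N}`, where `H` averages translates of `F(z) =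
Φ(empiricalMeasure z)` over the law of `Z`.

Smoothness: `ρ_n` is a trigonometric polynomial, hence so is `H`
(`IsTrigDensity.isTrigPolynomial_integral`). Thus `Φ_n` is a polynomial in finitely many integrals
of trigonometric monomials against `m`, and its flat derivatives are of the same type, with explicit
kernels `flatKernelSeq H ℓ`.

Convergence: replacing the laws of the points by Dirac masses one at a time, in the manner of
Lindeberg, costs `O(N⁻²)` per point: the first-order term has mean zero and the second flat
derivative is bounded. The total is `O(N⁻¹)` (`abs_integral_empiricalMeasure_sub_le`). The shifts
`Z_i` are absorbed by the uniform continuity of the first flat derivative (`abs_smoothed_sub_le`).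

Uniform bounds: the flat derivatives of `Φ_n` of orders 1 and 2 average sums of first and mixed
second differences of `H`. Moving one point of an empirical measure is a perturbation of size `N⁻¹`,
so first differences of `F` are `O(N⁻¹)`, and mixed differences in distinct slots are `O(N⁻²)`, with
constants taken from the sup or Hölder bounds of the flat derivatives of `Φ`. This survives
averaging over translates (`HasDiffBound.integral_add`). Summing `N` first differences, or `N²`
mixed ones together with `N` diagonal terms of size `N⁻¹`, gives bounds free of `N`. -/

/-! ### Instances on the torus -/

section TorusInstances

instance Torus.instBorelSpace (d : ℕ) : BorelSpace (Torus d) := inferInstance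

instance Torus.instOpensMeasurableSpace (d : ℕ) : OpensMeasurableSpace (Torus d) := inferInstance

instance Torus.instSecondCountableTopology (d : ℕ) : SecondCountableTopology (Torus d) :=
  inferInstance

instance Torus.instIsAddHaarMeasure (d : ℕ) :
    Measure.IsAddHaarMeasure (volume : Measure (Torus d)) := inferInstance

noncomputable instance ProbTorus.instTopologicalSpace (d : ℕ) : TopologicalSpace (ProbTorus d) :=
  inferInstance

end TorusInstances

/-! ### Continuous functions on compact spaces -/

section Compactness

variable {X Y : Type*} [TopologicalSpace X] [CompactSpace X]

lemma Continuous.exists_abs_le {f : X → ℝ} (hf : Continuous f) : ∃ C, ∀ x, |f x| ≤ C := by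
  obtain ⟨C, hC⟩ := (isCompact_range hf).isBounded.exists_norm_le
  exact ⟨C, fun x => hC _ ⟨x, rfl⟩⟩

/-- Currying gives a continuous map from the compact space `Y` into `C(X, ℝ)` with the sup norm.
Heine–Cantor makes it uniformly continuous, which is equicontinuity uniform over `X`. -/
lemma Continuous.uniformEquicontinuous_of_compactSpace [UniformSpace Y] [CompactSpace Y]
    {f : X → Y → ℝ} (hf : Continuous fun p : X × Y => f p.1 p.2) : UniformEquicontinuous f := by
  let g : C(Y, C(X, ℝ)) := ContinuousMap.curry ⟨fun p : Y × X => f p.2 p.1, by fun_prop⟩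
  have hg := CompactSpace.uniformContinuous_of_continuous g.continuous
  rw [Metric.uniformEquicontinuous_iff_right]
  intro ε hε
  filter_upwards [hg (Metric.dist_mem_uniformity hε)] with p hp x
  exact (ContinuousMap.dist_apply_le_dist x).trans_lt hp

lemma Continuous.integrable_of_compactSpace [MeasurableSpace X] [OpensMeasurableSpace X]
    {μ : Measure X} [IsFiniteMeasure μ] {f : X → ℝ} (hf : Continuous f) : Integrable f μ :=
  hf.integrable_of_hasCompactSupport (HasCompactSupport.of_compactSpace f)

lemma Continuous.integral_of_compactSpace [MeasurableSpace X] [OpensMeasurableSpace X]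
    [TopologicalSpace Y] [FirstCountableTopology Y] [LocallyCompactSpace Y]
    {μ : Measure X} [IsFiniteMeasure μ] {f : Y → X → ℝ}
    (hf : Continuous fun p : Y × X => f p.1 p.2) : Continuous fun y => ∫ x, f y x ∂μ := by
  simpa using continuous_parametric_integral_of_continuous (μ := μ) (f := f) hf isCompact_univ

lemma Continuous.integral_sub_of_compactSpace [MeasurableSpace X] [OpensMeasurableSpace X]
    {μ : Measure X} [IsFiniteMeasure μ] {f g : X → ℝ} (hf : Continuous f) (hg : Continuous g) :
    ∫ x, (f x - g x) ∂μ = ∫ x, f x ∂μ - ∫ x, g x ∂μ :=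
  integral_sub hf.integrable_of_compactSpace hg.integrable_of_compactSpace

end Compactness

/-! ### Integration against convex combinations of measures -/

section Mixture

variable {d : ℕ}

lemma integral_mixture (s : unitInterval) (m m' : ProbTorus d) {f : Torus d → ℝ}
    (hf : Continuous f) :
    ∫ x, f x ∂(mixture s m m' : Measure (Torus d)) =
      (1 - s) * ∫ x, f x ∂(m : Measure (Torus d)) + s * ∫ x, f x ∂(m' : Measure (Torus d)) := by
  have h0 : (0 : ℝ) ≤ s := s.2.1
  have h1 : (0 : ℝ) ≤ 1 - s := sub_nonneg.2 s.2.2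
  change ∫ x, f x ∂(ENNReal.ofReal (1 - s) • (m : Measure (Torus d)) +
    ENNReal.ofReal s • (m' : Measure (Torus d))) = _
  rw [integral_add_measure (hf.integrable_of_compactSpace.smul_measure ENNReal.ofReal_ne_top)
    (hf.integrable_of_compactSpace.smul_measure ENNReal.ofReal_ne_top), integral_smul_measure,
    integral_smul_measure, ENNReal.toReal_ofReal h0, ENNReal.toReal_ofReal h1, smul_eq_mul,
    smul_eq_mul]

lemma continuous_mixture (m m' : ProbTorus d) : Continuous fun s => mixture s m m' := by
  rw [ProbabilityMeasure.continuous_iff_forall_continuousMap_continuous_integral]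
  intro f
  simp_rw [integral_mixture _ m m' f.continuous]
  fun_prop

lemma continuous_integral_torus {f : Torus d → ℝ} (hf : Continuous f) :
    Continuous fun m : ProbTorus d => ∫ x, f x ∂(m : Measure (Torus d)) :=
  ProbabilityMeasure.continuous_integral_continuousMap (⟨f, hf⟩ : C(Torus d, ℝ))

end Mixture

/-! ### Averages of `N` probability measures -/

section Average

variable {d N : ℕ} [NeZero N]

/-- The arithmetic mean of finitely many probability measures. -/
noncomputable def averageMeasure (ξ : Fin N → ProbTorus d) : ProbTorus d :=
  ⟨(N : ENNReal)⁻¹ • ∑ i, (ξ i : Measure (Torus d)),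
    ⟨by simp [ENNReal.inv_mul_cancel (Nat.cast_ne_zero.2 (NeZero.ne N)) (ENNReal.natCast_ne_top N)]⟩⟩

lemma integral_averageMeasure (ξ : Fin N → ProbTorus d) {f : Torus d → ℝ} (hf : Continuous f) :
    ∫ x, f x ∂(averageMeasure ξ : Measure (Torus d)) =
      (N : ℝ)⁻¹ * ∑ i, ∫ x, f x ∂(ξ i : Measure (Torus d)) := by
  change ∫ x, f x ∂((N : ENNReal)⁻¹ • ∑ i, (ξ i : Measure (Torus d))) = _
  rw [integral_smul_measure, integral_finsetSum_measure
    fun i _ => hf.integrable_of_compactSpace]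
  simp

lemma continuous_averageMeasure : Continuous (averageMeasure (d := d) (N := N)) := by
  rw [ProbabilityMeasure.continuous_iff_forall_continuousMap_continuous_integral]
  intro f
  simp_rw [integral_averageMeasure _ f.continuous]
  exact continuous_const.mul (continuous_finsetSum _ fun i _ =>
    (continuous_integral_torus f.continuous).comp (continuous_apply i))

lemma probTorus_ext {m m' : ProbTorus d}
    (h : ∀ f : Torus d → ℝ, Continuous f →
      ∫ x, f x ∂(m : Measure (Torus d)) = ∫ x, f x ∂(m' : Measure (Torus d))) : m = m' := by
  exact ProbabilityMeasure.toMeasure_injective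
    (ext_of_forall_integral_eq_of_IsFiniteMeasure fun f => h f f.continuous)

lemma integral_averageMeasure_update (ξ : Fin N → ProbTorus d) (i : Fin N) (p : ProbTorus d)
    {f : Torus d → ℝ} (hf : Continuous f) :
    ∫ x, f x ∂(averageMeasure (Function.update ξ i p) : Measure (Torus d)) =
      (N : ℝ)⁻¹ * (∫ x, f x ∂(p : Measure (Torus d)) +
        ∑ j ∈ Finset.univ.erase i, ∫ x, f x ∂(ξ j : Measure (Torus d))) := by
  rw [integral_averageMeasure _ hf, ← Finset.add_sum_erase _ _ (Finset.mem_univ i)]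
  congr 2
  · simp
  · exact Finset.sum_congr rfl fun j hj => by rw [Function.update_of_ne (Finset.ne_of_mem_erase hj)]

/-- Averages are affine in each slot, so the segment joining two averages that differ in one slot
only moves that slot. -/
lemma mixture_averageMeasure_update (ξ : Fin N → ProbTorus d) (i : Fin N) (s : unitInterval)
    (p q : ProbTorus d) :
    mixture s (averageMeasure (Function.update ξ i q)) (averageMeasure (Function.update ξ i p)) =
      averageMeasure (Function.update ξ i (mixture s q p)) :=
  probTorus_ext fun f hf => by
    simp_rw [integral_mixture _ _ _ hf, integral_averageMeasure_update _ _ _ hf,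
      integral_mixture _ _ _ hf]
    ring

end Average

/-! ### Resampling one coordinate of a product measure -/

section UpdateIntegral

variable {ι X : Type*} [Fintype ι] [DecidableEq ι] [MeasurableSpace X]

/-- Replacing one of several independent coordinates by a fresh independent copy leaves the joint
law unchanged; it is checked on boxes. -/
lemma measurePreserving_update (p : ι → Measure X) [∀ i, IsProbabilityMeasure (p i)] (i : ι) :
    MeasurePreserving (fun zy : (ι → X) × X => Function.update zy.1 i zy.2)
      ((Measure.pi p).prod (p i)) (Measure.pi p) := by
  have hm : Measurable fun zy : (ι → X) × X => Function.update zy.1 i zy.2 := by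
    refine measurable_pi_lambda _ fun j => ?_
    by_cases h : j = i
    · subst h; simpa using measurable_snd
    · simpa [Function.update_of_ne h, Function.comp_def] using
        (measurable_pi_apply j).comp measurable_fst
  refine ⟨hm, (Measure.pi_eq fun s hs => ?_).symm⟩
  rw [Measure.map_apply hm (MeasurableSet.univ_pi hs)]
  have : (fun zy : (ι → X) × X => Function.update zy.1 i zy.2) ⁻¹' Set.univ.pi s =
      (Set.univ.pi (Function.update s i Set.univ)) ×ˢ s i := by
    ext ⟨z, y⟩
    simp only [Set.mem_preimage, Set.mem_pi, Set.mem_univ, true_implies, Set.mem_prod]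
    constructor
    · refine fun h => ⟨fun j => ?_, by simpa using h i⟩
      by_cases hj : j = i
      · subst hj; simp
      · simpa [Function.update_of_ne hj] using h j
    · rintro ⟨h, hy⟩ j
      by_cases hj : j = i
      · subst hj; simpa
      · simpa [Function.update_of_ne hj] using h j
  rw [this, Measure.prod_prod, Measure.pi_pi, ← Finset.mul_prod_erase _ _ (Finset.mem_univ i),
    ← Finset.mul_prod_erase _ (fun j => p j (s j)) (Finset.mem_univ i)]
  simp only [Function.update_self, measure_univ, one_mul]
  rw [mul_comm]
  congr 1
  exact Finset.prod_congr rfl fun j hj => by rw [Function.update_of_ne (Finset.ne_of_mem_erase hj)]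

lemma integral_pi_eq_integral_update [TopologicalSpace X] [CompactSpace X]
    [SecondCountableTopology X] [BorelSpace X] (p : ι → Measure X)
    [∀ i, IsProbabilityMeasure (p i)] (i : ι) {G : (ι → X) → ℝ} (hG : Continuous G) :
    ∫ z, G z ∂Measure.pi p = ∫ z, ∫ y, G (Function.update z i y) ∂p i ∂Measure.pi p := by
  have h := measurePreserving_update p i
  conv_lhs => rw [← h.map_eq]
  rw [integral_map h.measurable.aemeasurable hG.aestronglyMeasurable]
  refine integral_prod (fun zy : (ι → X) × X => G (Function.update zy.1 i zy.2)) ?_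
  exact Continuous.integrable_of_compactSpace (by fun_prop)

end UpdateIntegral

/-! ### Linear functional derivatives and differences of averages -/

section LinearDerivative

variable {d N : ℕ}

/-- `U'` is a jointly continuous linear functional derivative of `U`, without normalisation. -/
structure IsLinearDeriv (U : ProbTorus d → ℝ) (U' : ProbTorus d → Torus d → ℝ) : Prop where
  continuous : Continuous fun p : ProbTorus d × Torus d => U' p.1 p.2
  sub_eq : ∀ m m' : ProbTorus d, U m' - U m =
    ∫ s : unitInterval, ((∫ y, U' (mixture s m m') y ∂(m' : Measure (Torus d))) -
      ∫ y, U' (mixture s m m') y ∂(m : Measure (Torus d)))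

lemma continuous_integral_mixture {U' : ProbTorus d → Torus d → ℝ}
    (h : Continuous fun p : ProbTorus d × Torus d => U' p.1 p.2) (m m' n : ProbTorus d) :
    Continuous fun s : unitInterval =>
      ∫ y, U' (mixture s m m') y ∂(n : Measure (Torus d)) := by
  have := continuous_mixture m m'
  refine Continuous.integral_of_compactSpace ?_
  exact h.comp ((this.comp continuous_fst).prodMk continuous_snd)

lemma IsLinearDeriv.continuous_apply {U : ProbTorus d → ℝ} {U' : ProbTorus d → Torus d → ℝ}
    (h : IsLinearDeriv U U') (m : ProbTorus d) : Continuous (U' m) :=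
  h.continuous.comp (Continuous.prodMk_right m)

lemma IsLinearDeriv.add {U W : ProbTorus d → ℝ} {U' W' : ProbTorus d → Torus d → ℝ}
    (hU : IsLinearDeriv U U') (hW : IsLinearDeriv W W') :
    IsLinearDeriv (fun m => U m + W m) (fun m y => U' m y + W' m y) := by
  refine ⟨hU.continuous.add hW.continuous, fun m m' => ?_⟩
  have e : ∀ s (n : ProbTorus d), ∫ y, (U' (mixture s m m') y + W' (mixture s m m') y)
      ∂(n : Measure (Torus d)) = ∫ y, U' (mixture s m m') y ∂(n : Measure (Torus d)) +
        ∫ y, W' (mixture s m m') y ∂(n : Measure (Torus d)) := fun s n =>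
    integral_add (hU.continuous_apply _).integrable_of_compactSpace
      (hW.continuous_apply _).integrable_of_compactSpace
  simp_rw [e]
  rw [add_sub_add_comm, hU.sub_eq, hW.sub_eq, ← integral_add]
  · exact integral_congr_ae (Eventually.of_forall fun s => by ring)
  · exact ((continuous_integral_mixture hU.continuous _ _ _).sub
      (continuous_integral_mixture hU.continuous _ _ _)).integrable_of_compactSpace
  · exact ((continuous_integral_mixture hW.continuous _ _ _).sub
      (continuous_integral_mixture hW.continuous _ _ _)).integrable_of_compactSpace

lemma IsLinearDeriv.const_mul {U : ProbTorus d → ℝ} {U' : ProbTorus d → Torus d → ℝ}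
    (hU : IsLinearDeriv U U') (c : ℝ) :
    IsLinearDeriv (fun m => c * U m) (fun m y => c * U' m y) :=
  ⟨continuous_const.mul hU.continuous, fun m m' => by
    simp_rw [integral_const_mul, ← mul_sub, hU.sub_eq, integral_const_mul]⟩

lemma IsLinearDeriv.sub {U W : ProbTorus d → ℝ} {U' W' : ProbTorus d → Torus d → ℝ}
    (hU : IsLinearDeriv U U') (hW : IsLinearDeriv W W') :
    IsLinearDeriv (fun m => U m - W m) (fun m y => U' m y - W' m y) := by
  simpa only [neg_one_mul, ← sub_eq_add_neg] using hU.add (hW.const_mul (-1))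

lemma abs_integral_le_of_abs_le {X : Type*} [MeasurableSpace X] (μ : Measure X)
    [IsProbabilityMeasure μ] {f : X → ℝ} {C : ℝ} (h : ∀ x, |f x| ≤ C) : |∫ x, f x ∂μ| ≤ C := by
  simpa using norm_integral_le_of_norm_le_const (μ := μ) (Eventually.of_forall
    fun x => (Real.norm_eq_abs _).trans_le (h x))

lemma IsLinearDeriv.abs_sub_le {U : ProbTorus d → ℝ} {U' : ProbTorus d → Torus d → ℝ}
    (h : IsLinearDeriv U U') {m m' : ProbTorus d} {B : ℝ}
    (hB : ∀ n, |∫ y, U' n y ∂(m' : Measure (Torus d)) - ∫ y, U' n y ∂(m : Measure (Torus d))| ≤ B) :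
    |U m' - U m| ≤ B := by
  rw [h.sub_eq]
  exact abs_integral_le_of_abs_le _ fun s => hB _

variable [NeZero N]

/-- The two averages differ by `N⁻¹ (p - q)`. This is the source of every factor `N⁻¹` below. -/
lemma IsLinearDeriv.averageMeasure_update_sub {U : ProbTorus d → ℝ}
    {U' : ProbTorus d → Torus d → ℝ} (h : IsLinearDeriv U U') (ξ : Fin N → ProbTorus d) (i : Fin N)
    (p q : ProbTorus d) :
    U (averageMeasure (Function.update ξ i p)) - U (averageMeasure (Function.update ξ i q)) =
      (N : ℝ)⁻¹ * ∫ s : unitInterval,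
        ((∫ y, U' (averageMeasure (Function.update ξ i (mixture s q p))) y
          ∂(p : Measure (Torus d))) -
        ∫ y, U' (averageMeasure (Function.update ξ i (mixture s q p))) y
          ∂(q : Measure (Torus d))) := by
  rw [h.sub_eq, ← integral_const_mul]
  refine integral_congr_ae (Eventually.of_forall fun s => ?_)
  simp only
  rw [mixture_averageMeasure_update, integral_averageMeasure_update _ _ _ (h.continuous_apply _),
    integral_averageMeasure_update _ _ _ (h.continuous_apply _)]
  ring

lemma IsLinearDeriv.abs_averageMeasure_update_sub_le {U : ProbTorus d → ℝ}
    {U' : ProbTorus d → Torus d → ℝ} (h : IsLinearDeriv U U') (ξ : Fin N → ProbTorus d) (i : Fin N)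
    {p q : ProbTorus d} {B : ℝ}
    (hB : ∀ n, |∫ y, U' n y ∂(p : Measure (Torus d)) - ∫ y, U' n y ∂(q : Measure (Torus d))| ≤ B) :
    |U (averageMeasure (Function.update ξ i p)) - U (averageMeasure (Function.update ξ i q))| ≤
      (N : ℝ)⁻¹ * B := by
  rw [h.averageMeasure_update_sub, abs_mul, abs_of_nonneg (by positivity)]
  gcongr
  exact abs_integral_le_of_abs_le _ fun s => hB _

lemma integral_diracProba (a : Torus d) (f : Torus d → ℝ) :
    ∫ y, f y ∂(diracProba a : Measure (Torus d)) = f a := by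
  change ∫ y, f y ∂(Measure.dirac a) = f a
  exact integral_dirac f a

lemma IsLinearDeriv.abs_averageMeasure_update_diracProba_sub_le {U : ProbTorus d → ℝ}
    {U' : ProbTorus d → Torus d → ℝ} (h : IsLinearDeriv U U') (ξ : Fin N → ProbTorus d) (i : Fin N)
    {a a' : Torus d} {B : ℝ} (hB : ∀ n, |U' n a - U' n a'| ≤ B) :
    |U (averageMeasure (Function.update ξ i (diracProba a))) -
      U (averageMeasure (Function.update ξ i (diracProba a')))| ≤ (N : ℝ)⁻¹ * B :=
  h.abs_averageMeasure_update_sub_le ξ i fun n => by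
    simpa only [integral_diracProba] using hB n

/-- The one-slot formula is applied twice: to `U` in slot `i`, then to `U₁(·, a) - U₁(·, a')` in
slot `j`. Each application contributes a factor `N⁻¹`. -/
lemma abs_second_difference_averageMeasure_le {U : ProbTorus d → ℝ}
    {U₁ : ProbTorus d → Torus d → ℝ} {U₂ : ProbTorus d → Torus d → Torus d → ℝ}
    (h₁ : IsLinearDeriv U U₁) (h₂ : ∀ a, IsLinearDeriv (fun m => U₁ m a) fun m => U₂ m a)
    (ξ : Fin N → ProbTorus d) {i j : Fin N} (hij : i ≠ j) {a a' b b' : Torus d} {B : ℝ}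
    (hB : ∀ n, |(U₂ n a b - U₂ n a' b) - (U₂ n a b' - U₂ n a' b')| ≤ B) :
    |(U (averageMeasure
          (Function.update (Function.update ξ j (diracProba b)) i (diracProba a))) -
        U (averageMeasure
          (Function.update (Function.update ξ j (diracProba b)) i (diracProba a')))) -
      (U (averageMeasure
          (Function.update (Function.update ξ j (diracProba b')) i (diracProba a))) -
        U (averageMeasure
          (Function.update (Function.update ξ j (diracProba b')) i (diracProba a'))))| ≤
      (N : ℝ)⁻¹ * ((N : ℝ)⁻¹ * B) := by
  have hc : ∀ c e : Torus d, Continuous fun s : unitInterval =>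
      U₁ (averageMeasure (Function.update (Function.update ξ j (diracProba c)) i
        (mixture s (diracProba a') (diracProba a)))) e := fun c e => by
    have h3 := continuous_mixture (diracProba a') (diracProba a)
    have h4 := continuous_averageMeasure.comp ((continuous_const
      (y := Function.update ξ j (diracProba c))).update i h3)
    exact h₁.continuous.comp (h4.prodMk continuous_const)
  rw [h₁.averageMeasure_update_sub, h₁.averageMeasure_update_sub, ← mul_sub, abs_mul,
    abs_of_nonneg (by positivity : (0 : ℝ) ≤ (N : ℝ)⁻¹)]
  gcongr
  simp only [integral_diracProba]
  rw [← Continuous.integral_sub_of_compactSpace ?_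
    ?_]
  rotate_left
  · exact (hc b a).sub (hc b a')
  · exact (hc b' a).sub (hc b' a')
  refine abs_integral_le_of_abs_le _ fun s => ?_
  -- Here `i ≠ j` is essential: slot `j` becomes the outermost update, with the interpolated measure
  -- frozen in slot `i`.
  rw [Function.update_comm hij.symm, Function.update_comm hij.symm]
  exact ((h₂ a).sub (h₂ a')).abs_averageMeasure_update_diracProba_sub_le _ j hB

end LinearDerivative

/-! ### Law of large numbers with rate `N⁻¹` -/

section LawOfLargeNumbers

variable {d N : ℕ} [NeZero N] {U : ProbTorus d → ℝ} {U₁ : ProbTorus d → Torus d → ℝ}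
  {U₂ : ProbTorus d → Torus d → Torus d → ℝ} {C : ℝ}

lemma abs_integral_sub_integral_le {p q : ProbTorus d} {f : Torus d → ℝ} (hf : ∀ x, |f x| ≤ C) :
    |∫ y, f y ∂(p : Measure (Torus d)) - ∫ y, f y ∂(q : Measure (Torus d))| ≤ 2 * C := by
  have h1 := abs_integral_le_of_abs_le (p : Measure (Torus d)) hf
  have h2 := abs_integral_le_of_abs_le (q : Measure (Torus d)) hf
  rw [abs_le] at *
  constructor <;> linarith

/-- First-order expansion at `n₀`, with `p` in slot `i`: the linear term has zero `p`-mean. The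
remainder involves increments of `U₁` between averages differing in one slot, at most `2C/N` each,
once at `y` and once in the `p`-mean; hence `4C/N²`. -/
lemma abs_integral_averageMeasure_update_sub_le (hU : Continuous U) (h₁ : IsLinearDeriv U U₁)
    (h₂ : ∀ a, IsLinearDeriv (fun m => U₁ m a) fun m => U₂ m a) (hC : ∀ n a b, |U₂ n a b| ≤ C)
    (ξ : Fin N → ProbTorus d) (i : Fin N) (p : ProbTorus d) :
    |∫ y, (U (averageMeasure (Function.update ξ i (diracProba y))) -
      U (averageMeasure (Function.update ξ i p))) ∂(p : Measure (Torus d))| ≤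
      (N : ℝ)⁻¹ * ((N : ℝ)⁻¹ * (4 * C)) := by
  set n₀ := averageMeasure (Function.update ξ i p) with hn₀
  have hstep : ∀ (r : ProbTorus d) a, |U₁ (averageMeasure (Function.update ξ i r)) a - U₁ n₀ a| ≤
      (N : ℝ)⁻¹ * (2 * C) := fun r a =>
    (h₂ a).abs_averageMeasure_update_sub_le ξ i fun n => abs_integral_sub_integral_le (hC n a)
  have hcU : Continuous fun y => U (averageMeasure (Function.update ξ i (diracProba y))) :=
    hU.comp (continuous_averageMeasure.comp ((continuous_const (y := ξ)).update i
      continuous_diracProba))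
  have hc₀ : Continuous (U₁ n₀) := h₁.continuous_apply _
  have hzero : ∫ y, (U₁ n₀ y - ∫ z, U₁ n₀ z ∂(p : Measure (Torus d))) ∂(p : Measure (Torus d)) =
      0 := by
    rw [hc₀.integral_sub_of_compactSpace continuous_const]
    simp
  have hmain : ∀ y, |(U (averageMeasure (Function.update ξ i (diracProba y))) - U n₀) -
      (N : ℝ)⁻¹ * (U₁ n₀ y - ∫ z, U₁ n₀ z ∂(p : Measure (Torus d)))| ≤
      (N : ℝ)⁻¹ * ((N : ℝ)⁻¹ * (4 * C)) := fun y => by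
    have hi : Continuous fun s : unitInterval =>
        averageMeasure (Function.update ξ i (mixture s p (diracProba y))) :=
      continuous_averageMeasure.comp ((continuous_const (y := ξ)).update i (continuous_mixture _ _))
    have hi₁ : Continuous fun s : unitInterval =>
        U₁ (averageMeasure (Function.update ξ i (mixture s p (diracProba y)))) y :=
      h₁.continuous.comp (hi.prodMk continuous_const)
    have hi₂ : Continuous fun s : unitInterval => ∫ z,
        U₁ (averageMeasure (Function.update ξ i (mixture s p (diracProba y)))) z
          ∂(p : Measure (Torus d)) :=
      Continuous.integral_of_compactSpace
        (h₁.continuous.comp ((hi.comp continuous_fst).prodMk continuous_snd))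
    rw [hn₀, h₁.averageMeasure_update_sub, ← hn₀, ← mul_sub, abs_mul,
      abs_of_nonneg (by positivity : (0 : ℝ) ≤ (N : ℝ)⁻¹)]
    gcongr
    simp only [integral_diracProba]
    have hconst : U₁ n₀ y - ∫ z, U₁ n₀ z ∂(p : Measure (Torus d)) = ∫ _s : unitInterval,
        (U₁ n₀ y - ∫ z, U₁ n₀ z ∂(p : Measure (Torus d))) := by simp
    rw [hconst, ← Continuous.integral_sub_of_compactSpace ?_ continuous_const]
    rotate_left
    · exact hi₁.sub hi₂
    refine abs_integral_le_of_abs_le _ fun s => ?_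
    have e1 := hstep (mixture s p (diracProba y)) y
    have e2 := abs_integral_le_of_abs_le (p : Measure (Torus d))
      (hstep (mixture s p (diracProba y)))
    rw [(h₁.continuous_apply _).integral_sub_of_compactSpace hc₀] at e2
    rw [abs_le] at *
    constructor <;> linarith
  have hint : ∫ y, (U (averageMeasure (Function.update ξ i (diracProba y))) - U n₀)
      ∂(p : Measure (Torus d)) =
      ∫ y, ((U (averageMeasure (Function.update ξ i (diracProba y))) - U n₀) -
        (N : ℝ)⁻¹ * (U₁ n₀ y - ∫ z, U₁ n₀ z ∂(p : Measure (Torus d)))) ∂(p : Measure (Torus d)) := by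
    have e := (hcU.sub continuous_const).integral_sub_of_compactSpace
      (μ := (p : Measure (Torus d))) (f := fun y => U (averageMeasure
        (Function.update ξ i (diracProba y))) - U n₀) (continuous_const.mul (hc₀.sub continuous_const))
      (g := fun y => (N : ℝ)⁻¹ * (U₁ n₀ y - ∫ z, U₁ n₀ z ∂(p : Measure (Torus d))))
    rw [e, integral_const_mul, hzero]
    ring
  rw [hint]
  exact abs_integral_le_of_abs_le _ hmain

/-- The empirical measure of finitely many points. -/
noncomputable def empiricalMeasure (z : Fin N → Torus d) : ProbTorus d :=
  averageMeasure fun i => diracProba (z i)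

lemma continuous_empiricalMeasure : Continuous (empiricalMeasure (d := d) (N := N)) :=
  continuous_averageMeasure.comp
    (continuous_pi fun i => continuous_diracProba.comp (continuous_apply i))

lemma empiricalMeasure_update (z : Fin N → Torus d) (i : Fin N) (y : Torus d) :
    empiricalMeasure (Function.update z i y) =
      averageMeasure (Function.update (fun j => diracProba (z j)) i (diracProba y)) := by
  unfold empiricalMeasure
  congr 1
  funext j
  exact Function.apply_update (fun _ => diracProba) z i y j

/-- One replacement step. The configuration `ζ z` carries `p i` in slot `i` and does not depend on
`z i`, so resampling `z i` reduces the claim to the one-slot estimate with the other points frozen.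
-/
lemma abs_integral_update_diracProba_sub_le (hU : Continuous U) (h₁ : IsLinearDeriv U U₁)
    (h₂ : ∀ a, IsLinearDeriv (fun m => U₁ m a) fun m => U₂ m a) (hC : ∀ n a b, |U₂ n a b| ≤ C)
    (p : Fin N → ProbTorus d) (i : Fin N) {ζ : (Fin N → Torus d) → Fin N → ProbTorus d}
    (hζ : Continuous ζ) (hζi : ∀ z, Function.update (ζ z) i (p i) = ζ z)
    (hζ' : ∀ z y, ζ (Function.update z i y) = ζ z) :
    |∫ z, U (averageMeasure (Function.update (ζ z) i (diracProba (z i))))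
        ∂Measure.pi (fun i => (p i : Measure (Torus d))) -
      ∫ z, U (averageMeasure (ζ z)) ∂Measure.pi (fun i => (p i : Measure (Torus d)))| ≤
      (N : ℝ)⁻¹ * ((N : ℝ)⁻¹ * (4 * C)) := by
  have hc : Continuous fun q : (Fin N → Torus d) × Torus d =>
      U (averageMeasure (Function.update (ζ q.1) i (diracProba q.2))) :=
    hU.comp (continuous_averageMeasure.comp
      ((hζ.comp continuous_fst).update i (continuous_diracProba.comp continuous_snd)))
  have hc' : Continuous fun z => U (averageMeasure (Function.update (ζ z) i (diracProba (z i)))) :=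
    hU.comp (continuous_averageMeasure.comp
      (hζ.update i (continuous_diracProba.comp (continuous_apply i))))
  have hc'' : Continuous fun z => U (averageMeasure (ζ z)) :=
    hU.comp (continuous_averageMeasure.comp hζ)
  rw [integral_pi_eq_integral_update (fun i => (p i : Measure (Torus d))) i hc',
    ← Continuous.integral_sub_of_compactSpace ?_ hc'']
  · refine abs_integral_le_of_abs_le _ fun z => ?_
    have e := abs_integral_averageMeasure_update_sub_le hU h₁ h₂ hC (ζ z) i (p i)
    have hcz : Continuous fun y => U (averageMeasure (Function.update (ζ z) i (diracProba y))) :=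
      hU.comp (continuous_averageMeasure.comp (continuous_const.update i continuous_diracProba))
    rw [hcz.integral_sub_of_compactSpace continuous_const, hζi, integral_const] at e
    simpa only [hζ', Function.update_self, probReal_univ, one_smul] using e
  · simp only [hζ', Function.update_self]
    exact Continuous.integral_of_compactSpace hc

/-- Lindeberg replacement: each of the `N` substitutions of `δ_{z_i}` for `p i` costs `4C/N²`. -/
lemma abs_integral_empiricalMeasure_sub_le (hU : Continuous U) (h₁ : IsLinearDeriv U U₁)
    (h₂ : ∀ a, IsLinearDeriv (fun m => U₁ m a) fun m => U₂ m a) (hC : ∀ n a b, |U₂ n a b| ≤ C)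
    (p : Fin N → ProbTorus d) :
    |∫ z, U (empiricalMeasure z) ∂Measure.pi (fun i => (p i : Measure (Torus d))) -
      U (averageMeasure p)| ≤ (N : ℝ)⁻¹ * (4 * C) := by
  classical
  -- Hybrid configurations: slots in `S` already hold random points, the others still hold their
  -- laws.
  let ξ : Finset (Fin N) → (Fin N → Torus d) → Fin N → ProbTorus d := fun S z i =>
    if i ∈ S then diracProba (z i) else p i
  have hξ : ∀ S, Continuous (ξ S) := fun S => by
    refine continuous_pi fun i => ?_
    by_cases hi : i ∈ S
    · simpa [ξ, hi, Function.comp_def] using continuous_diracProba.comp (continuous_apply i)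
    · simpa [ξ, hi] using continuous_const
  have key : ∀ S : Finset (Fin N),
      |∫ z, U (averageMeasure (ξ S z)) ∂Measure.pi (fun i => (p i : Measure (Torus d))) -
        U (averageMeasure p)| ≤ S.card * ((N : ℝ)⁻¹ * ((N : ℝ)⁻¹ * (4 * C))) := by
    intro S
    induction S using Finset.induction_on with
    | empty => simp [ξ]
    | insert i S hi ih =>
      have e := abs_integral_update_diracProba_sub_le hU h₁ h₂ hC p i (hξ S)
        (fun z => by
          funext j
          by_cases hj : j = i
          · subst hj; simp [ξ, hi]
          · simp [Function.update_of_ne hj])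
        (fun z y => by
          funext j
          by_cases hj : j = i
          · subst hj; simp [ξ, hi]
          · simp [ξ, Function.update_of_ne hj])
      have e1 : ∀ z, Function.update (ξ S z) i (diracProba (z i)) = ξ (insert i S) z := fun z => by
        funext j
        by_cases hj : j = i
        · subst hj; simp [ξ]
        · simp [ξ, hj]
      simp only [e1] at e
      rw [Finset.card_insert_of_notMem hi]
      push_cast
      rw [abs_le] at *
      constructor <;> linarith
  have h := key Finset.univ
  have hN : (N : ℝ) ≠ 0 := Nat.cast_ne_zero.2 (NeZero.ne N)
  rw [Finset.card_univ, Fintype.card_fin, mul_inv_cancel_left₀ hN] at h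
  simpa [ξ, empiricalMeasure] using h

end LawOfLargeNumbers

/-! ### Trigonometric monomials and their derivatives -/

section TrigonometricMonomials

variable {d : ℕ}

/-- The real trigonometric monomial `x ↦ Re (c e^{2 π i k ⬝ x})`, for `a = (c, k)`. -/
noncomputable def trigMonomial (a : ℂ × (Fin d → ℤ)) (x : Torus d) : ℝ :=
  (a.1 * UnitAddTorus.mFourier a.2 x).re

/-- The coefficients of the partial derivative of order `β` of a trigonometric monomial. -/
noncomputable def trigDeriv (β : Fin d → ℕ) (a : ℂ × (Fin d → ℤ)) : ℂ × (Fin d → ℤ) :=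
  (a.1 * ∏ j, (2 * Real.pi * Complex.I * a.2 j) ^ β j, a.2)

@[fun_prop]
lemma continuous_trigMonomial (a : ℂ × (Fin d → ℤ)) : Continuous (trigMonomial a) :=
  Complex.continuous_re.comp (continuous_const.mul (UnitAddTorus.mFourier a.2).continuous)

/-- The constant 1 is a monomial, so it can fill a slot whose factor has been removed without
changing the number of variables. -/
lemma trigMonomial_one_zero (x : Torus d) : trigMonomial ((1, 0) : ℂ × (Fin d → ℤ)) x = 1 := by
  simp [trigMonomial, UnitAddTorus.mFourier_zero]

lemma trigDeriv_zero (a : ℂ × (Fin d → ℤ)) : trigDeriv 0 a = a := by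
  simp [trigDeriv]

lemma trigDeriv_add_single (β : Fin d → ℕ) (j : Fin d) (a : ℂ × (Fin d → ℤ)) :
    trigDeriv (β + Pi.single j 1) a =
      ((trigDeriv β a).1 * (2 * Real.pi * Complex.I * a.2 j), a.2) := by
  have : ∏ i, (2 * Real.pi * Complex.I * a.2 i : ℂ) ^ (Pi.single j 1 : Fin d → ℕ) i =
      2 * Real.pi * Complex.I * a.2 j := by
    rw [Finset.prod_eq_single j (fun i _ hi => by simp [hi]) (by simp)]
    simp
  simp only [trigDeriv, Pi.add_apply, pow_add, Finset.prod_mul_distrib, this]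
  rw [← mul_assoc a.1]

lemma mFourier_add_single (k : Fin d → ℤ) (x : Torus d) (j : Fin d) (t : UnitAddCircle) :
    UnitAddTorus.mFourier k (x + Pi.single j t) =
      UnitAddTorus.mFourier k x * fourier (k j) t := by
  simp only [UnitAddTorus.mFourier, ContinuousMap.coe_mk]
  rw [← Finset.mul_prod_erase _ _ (Finset.mem_univ j),
    ← Finset.mul_prod_erase _ (fun i => fourier (k i) (x i)) (Finset.mem_univ j)]
  have h1 : fourier (k j) ((x + Pi.single j t : Torus d) j) =
      fourier (k j) (x j) * fourier (k j) t := by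
    simp [fourier_apply, AddCircle.toCircle_add]
  have h2 : ∏ i ∈ Finset.univ.erase j, fourier (k i) ((x + Pi.single j t : Torus d) i) =
      ∏ i ∈ Finset.univ.erase j, fourier (k i) (x i) :=
    Finset.prod_congr rfl fun i hi => by simp [Finset.ne_of_mem_erase hi]
  rw [h1, h2]
  ring

lemma hasDerivAt_trigMonomial (a : ℂ × (Fin d → ℤ)) (β : Fin d → ℕ) (x : Torus d) (j : Fin d) :
    HasDerivAt (fun t : ℝ => trigMonomial (trigDeriv β a) (x + Pi.single j (t : UnitAddCircle)))
      (trigMonomial (trigDeriv (β + Pi.single j 1) a) x) 0 := by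
  have h := (hasDerivAt_fourier 1 (a.2 j) 0).const_mul
    ((trigDeriv β a).1 * UnitAddTorus.mFourier a.2 x)
  have h' := Complex.reCLM.hasFDerivAt.comp_hasDerivAt 0 h
  refine (h'.congr_deriv ?_).congr_of_eventuallyEq (Eventually.of_forall fun t => ?_)
  · simp only [trigMonomial, trigDeriv_add_single, Complex.reCLM_apply]
    congr 1
    simp
    ring
  · simp only [trigMonomial, mFourier_add_single, Function.comp, Complex.reCLM_apply, trigDeriv,
      mul_assoc]

end TrigonometricMonomials

/-! ### Polynomial functionals of a measure -/

section TensorKernels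

variable {d ℓ N : ℕ}

/-- A tensor product of trigonometric monomials in two groups of variables. -/
noncomputable def tensorKernel (g : Fin ℓ → ℂ × (Fin d → ℤ)) (h : Fin N → ℂ × (Fin d → ℤ)) :
    (Fin ℓ → Torus d) → (Fin N → Torus d) → ℝ :=
  fun y x => (∏ i, trigMonomial (g i) (y i)) * ∏ r, trigMonomial (h r) (x r)

variable (d ℓ N) in
/-- The real trigonometric polynomials in two groups of variables. -/
noncomputable def tensorSpan : Submodule ℝ ((Fin ℓ → Torus d) → (Fin N → Torus d) → ℝ) :=
  Submodule.span ℝ (Set.range fun p : (Fin ℓ → ℂ × (Fin d → ℤ)) × (Fin N → ℂ × (Fin d → ℤ)) =>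
    tensorKernel p.1 p.2)

lemma tensorKernel_mem (g : Fin ℓ → ℂ × (Fin d → ℤ)) (h : Fin N → ℂ × (Fin d → ℤ)) :
    tensorKernel g h ∈ tensorSpan d ℓ N :=
  Submodule.subset_span ⟨(g, h), rfl⟩

lemma tensorSpan_induction {P : ((Fin ℓ → Torus d) → (Fin N → Torus d) → ℝ) → Prop}
    (hgen : ∀ g h, P (tensorKernel g h)) (hzero : P 0)
    (hadd : ∀ K ∈ tensorSpan d ℓ N, ∀ K' ∈ tensorSpan d ℓ N, P K → P K' → P (K + K'))
    (hsmul : ∀ (c : ℝ), ∀ K ∈ tensorSpan d ℓ N, P K → P (c • K))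
    {K : (Fin ℓ → Torus d) → (Fin N → Torus d) → ℝ} (hK : K ∈ tensorSpan d ℓ N) : P K := by
  induction hK using Submodule.span_induction with
  | mem K h => obtain ⟨p, rfl⟩ := h; exact hgen _ _
  | zero => exact hzero
  | add K K' hK hK' h h' => exact hadd K hK K' hK' h h'
  | smul c K hK h => exact hsmul c K hK h

lemma continuous_of_mem_tensorSpan {K : (Fin ℓ → Torus d) → (Fin N → Torus d) → ℝ}
    (hK : K ∈ tensorSpan d ℓ N) :
    Continuous fun p : (Fin ℓ → Torus d) × (Fin N → Torus d) => K p.1 p.2 := by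
  refine tensorSpan_induction (P := fun K => Continuous fun p :
    (Fin ℓ → Torus d) × (Fin N → Torus d) => K p.1 p.2) ?_ ?_ ?_ ?_ hK
  · intro g h
    unfold tensorKernel
    fun_prop
  · exact continuous_const
  · exact fun K _ K' _ h h' => h.add h'
  · exact fun c K _ h => h.const_smul c

lemma continuous_apply_of_mem_tensorSpan {K : (Fin ℓ → Torus d) → (Fin N → Torus d) → ℝ}
    (hK : K ∈ tensorSpan d ℓ N) (y : Fin ℓ → Torus d) : Continuous (K y) :=
  (continuous_of_mem_tensorSpan hK).comp (Continuous.prodMk_right y)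

/-- The polynomial functional `m ↦ ∫ K(y, x) m^{⊗ N}(dx)` with parameter `y`. -/
noncomputable def polyFunctional (K : (Fin ℓ → Torus d) → (Fin N → Torus d) → ℝ)
    (m : ProbTorus d) (y : Fin ℓ → Torus d) : ℝ :=
  ∫ x, K y x ∂Measure.pi fun _ : Fin N => (m : Measure (Torus d))

lemma polyFunctional_zero (m : ProbTorus d) (y : Fin ℓ → Torus d) :
    polyFunctional (0 : (Fin ℓ → Torus d) → (Fin N → Torus d) → ℝ) m y = 0 := by
  simp [polyFunctional]

lemma polyFunctional_add {K K' : (Fin ℓ → Torus d) → (Fin N → Torus d) → ℝ}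
    (hK : K ∈ tensorSpan d ℓ N) (hK' : K' ∈ tensorSpan d ℓ N) (m : ProbTorus d)
    (y : Fin ℓ → Torus d) :
    polyFunctional (K + K') m y = polyFunctional K m y + polyFunctional K' m y :=
  integral_add (continuous_apply_of_mem_tensorSpan hK y).integrable_of_compactSpace
    (continuous_apply_of_mem_tensorSpan hK' y).integrable_of_compactSpace

lemma polyFunctional_smul (c : ℝ) (K : (Fin ℓ → Torus d) → (Fin N → Torus d) → ℝ)
    (m : ProbTorus d) (y : Fin ℓ → Torus d) :
    polyFunctional (c • K) m y = c * polyFunctional K m y :=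
  integral_const_mul c _

/-- By Fubini, a tensor product yields a product of linear functionals of `m`; the general case
follows by linearity through `tensorSpan_induction`. -/
lemma polyFunctional_tensorKernel (g : Fin ℓ → ℂ × (Fin d → ℤ)) (h : Fin N → ℂ × (Fin d → ℤ))
    (m : ProbTorus d) (y : Fin ℓ → Torus d) :
    polyFunctional (tensorKernel g h) m y = (∏ i, trigMonomial (g i) (y i)) *
      ∏ r, ∫ x, trigMonomial (h r) x ∂(m : Measure (Torus d)) := by
  unfold polyFunctional tensorKernel
  rw [integral_const_mul, integral_fintype_prod_eq_prod (fun r => trigMonomial (h r))]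

lemma continuous_polyFunctional {K : (Fin ℓ → Torus d) → (Fin N → Torus d) → ℝ}
    (hK : K ∈ tensorSpan d ℓ N) :
    Continuous fun p : ProbTorus d × (Fin ℓ → Torus d) => polyFunctional K p.1 p.2 := by
  refine tensorSpan_induction (P := fun K => Continuous fun p :
    ProbTorus d × (Fin ℓ → Torus d) => polyFunctional K p.1 p.2) ?_ ?_ ?_ ?_ hK
  · intro g h
    simp_rw [polyFunctional_tensorKernel]
    refine Continuous.mul (by fun_prop) (continuous_finsetProd _ fun r _ => ?_)
    exact (continuous_integral_torus (continuous_trigMonomial (h r))).comp continuous_fst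
  · simpa only [polyFunctional_zero] using continuous_const
  · intro K hK K' hK' h h'
    simp only [polyFunctional_add hK hK']
    exact h.add h'
  · intro c K hK h
    simp only [polyFunctional_smul]
    exact continuous_const.mul h

/-- One family `D` serves all orders `n` and all `m`. Its joint continuity in `(m, y)` is what later
yields bounds and equicontinuity uniform in `m`, by compactness. -/
lemma exists_isCrossedDeriv_polyFunctional {K : (Fin ℓ → Torus d) → (Fin N → Torus d) → ℝ}
    (hK : K ∈ tensorSpan d ℓ N) :
    ∃ D : (Fin ℓ → Fin d → ℕ) → ProbTorus d → (Fin ℓ → Torus d) → ℝ,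
      (∀ n m, IsCrossedDeriv n (polyFunctional K m) fun β => D β m) ∧
      ∀ β, Continuous fun p : ProbTorus d × (Fin ℓ → Torus d) => D β p.1 p.2 := by
  suffices h : ∃ D : (Fin ℓ → Fin d → ℕ) → ProbTorus d → (Fin ℓ → Torus d) → ℝ,
      (∀ m y, D 0 m y = polyFunctional K m y) ∧
      (∀ β i j m y, HasDerivAt (fun t : ℝ =>
        D β m (y + Pi.single i (Pi.single j (t : UnitAddCircle))))
        (D (β + Pi.single i (Pi.single j 1)) m y) 0) ∧
      ∀ β, Continuous fun p : ProbTorus d × (Fin ℓ → Torus d) => D β p.1 p.2 by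
    obtain ⟨D, h0, h1, h2⟩ := h
    exact ⟨D, fun n m => ⟨funext (h0 m), fun β _ => (h2 β).comp (Continuous.prodMk_right m),
      fun β i j _ y => h1 β i j m y⟩, h2⟩
  refine tensorSpan_induction (P := fun K =>
    ∃ D : (Fin ℓ → Fin d → ℕ) → ProbTorus d → (Fin ℓ → Torus d) → ℝ,
      (∀ m y, D 0 m y = polyFunctional K m y) ∧
      (∀ β i j m y, HasDerivAt (fun t : ℝ =>
        D β m (y + Pi.single i (Pi.single j (t : UnitAddCircle))))
        (D (β + Pi.single i (Pi.single j 1)) m y) 0) ∧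
      ∀ β, Continuous fun p : ProbTorus d × (Fin ℓ → Torus d) => D β p.1 p.2) ?_ ?_ ?_ ?_ hK
  · intro g h
    refine ⟨fun β => polyFunctional (tensorKernel (fun i => trigDeriv (β i) (g i)) h),
      fun m y => by simp [trigDeriv_zero], fun β i j m y => ?_,
      fun β => continuous_polyFunctional (tensorKernel_mem _ _)⟩
    simp_rw [polyFunctional_tensorKernel]
    refine HasDerivAt.mul_const ?_ _
    have e1 : ∀ t : ℝ, ∏ i', trigMonomial (trigDeriv (β i') (g i'))
        ((y + Pi.single i (Pi.single j (t : UnitAddCircle)) : Fin ℓ → Torus d) i') =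
        trigMonomial (trigDeriv (β i) (g i)) (y i + Pi.single j (t : UnitAddCircle)) *
          ∏ i' ∈ Finset.univ.erase i, trigMonomial (trigDeriv (β i') (g i')) (y i') := fun t => by
      rw [← Finset.mul_prod_erase _ _ (Finset.mem_univ i)]
      congr 1
      · simp
      · exact Finset.prod_congr rfl fun i' hi' => by simp [Finset.ne_of_mem_erase hi']
    have e2 : ∏ i', trigMonomial
        (trigDeriv ((β + Pi.single i (Pi.single j 1) : Fin ℓ → Fin d → ℕ) i') (g i')) (y i') =
        trigMonomial (trigDeriv (β i + Pi.single j 1) (g i)) (y i) *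
          ∏ i' ∈ Finset.univ.erase i, trigMonomial (trigDeriv (β i') (g i')) (y i') := by
      rw [← Finset.mul_prod_erase _ _ (Finset.mem_univ i)]
      congr 1
      · simp
      · exact Finset.prod_congr rfl fun i' hi' => by simp [Finset.ne_of_mem_erase hi']
    simp_rw [e1, e2]
    exact (hasDerivAt_trigMonomial _ _ _ _).mul_const _
  · exact ⟨fun _ _ _ => 0, fun m y => (polyFunctional_zero m y).symm,
      fun _ _ _ _ _ => hasDerivAt_const _ _, fun _ => continuous_const⟩
  · rintro K hK K' hK' ⟨D, h0, h1, h2⟩ ⟨D', h0', h1', h2'⟩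
    exact ⟨fun β m y => D β m y + D' β m y,
      fun m y => by rw [polyFunctional_add hK hK', ← h0, ← h0'],
      fun β i j m y => (h1 β i j m y).add (h1' β i j m y), fun β => (h2 β).add (h2' β)⟩
  · rintro c K hK ⟨D, h0, h1, h2⟩
    exact ⟨fun β m y => c * D β m y, fun m y => by rw [polyFunctional_smul, ← h0],
      fun β i j m y => (h1 β i j m y).const_mul c, fun β => continuous_const.mul (h2 β)⟩

end TensorKernels

/-! ### Flat derivatives of polynomial functionals -/

section FlatKernel

variable {d ℓ N : ℕ}

/-- The fundamental theorem of calculus along the segment from `A` to `B`. With `A`, `B` the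
integrals of the factors against `m`, `m'`, it is the defining identity of the flat derivative for a
tensor product. -/
lemma prod_sub_prod_eq_integral (A B : Fin N → ℝ) :
    ∏ r, B r - ∏ r, A r = ∫ s : unitInterval,
      ∑ r, (B r - A r) * ∏ r' ∈ Finset.univ.erase r, ((1 - (s : ℝ)) * A r' + s * B r') := by
  have hd : ∀ s : ℝ, HasDerivAt (fun s : ℝ => ∏ r, ((1 - s) * A r + s * B r))
      (∑ r, (B r - A r) * ∏ r' ∈ Finset.univ.erase r, ((1 - s) * A r' + s * B r')) s := fun s => by
    have h : ∀ r ∈ (Finset.univ : Finset (Fin N)),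
        HasDerivAt (fun s : ℝ => (1 - s) * A r + s * B r) (B r - A r) s := fun r _ =>
      ((((hasDerivAt_id s).const_sub 1).mul_const (A r)).add
        ((hasDerivAt_id s).mul_const (B r))).congr_deriv (by ring)
    refine (HasDerivAt.fun_finsetProd h).congr_deriv (Finset.sum_congr rfl fun r _ => ?_)
    rw [smul_eq_mul, mul_comm]
  have hi : ∫ s : unitInterval,
      ∑ r, (B r - A r) * ∏ r' ∈ Finset.univ.erase r, ((1 - (s : ℝ)) * A r' + s * B r') =
      ∫ s in (0 : ℝ)..1,
        ∑ r, (B r - A r) * ∏ r' ∈ Finset.univ.erase r, ((1 - s) * A r' + s * B r') := by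
    rw [intervalIntegral.integral_of_le zero_le_one, ← integral_Icc_eq_integral_Ioc]
    exact integral_subtype_comap measurableSet_Icc (fun s : ℝ =>
      ∑ r, (B r - A r) * ∏ r' ∈ Finset.univ.erase r, ((1 - s) * A r' + s * B r'))
  rw [hi, intervalIntegral.integral_eq_sub_of_hasDerivAt (fun s _ => hd s)
    (Continuous.intervalIntegrable (by fun_prop) _ _)]
  simp

/-- The kernel of the normalised flat derivative of a polynomial functional. -/
noncomputable def flatKernel (K : (Fin ℓ → Torus d) → (Fin N → Torus d) → ℝ) :
    (Fin (ℓ + 1) → Torus d) → (Fin N → Torus d) → ℝ :=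
  fun y x => ∑ r, (K (Fin.init y) (Function.update x r (y (Fin.last ℓ))) - K (Fin.init y) x)

lemma flatKernel_add (K K' : (Fin ℓ → Torus d) → (Fin N → Torus d) → ℝ) :
    flatKernel (K + K') = flatKernel K + flatKernel K' := by
  funext y x
  simp only [flatKernel, Pi.add_apply, ← Finset.sum_add_distrib]
  exact Finset.sum_congr rfl fun r _ => by ring

lemma flatKernel_smul (c : ℝ) (K : (Fin ℓ → Torus d) → (Fin N → Torus d) → ℝ) :
    flatKernel (c • K) = c • flatKernel K := by
  funext y x
  simp only [flatKernel, Pi.smul_apply, smul_eq_mul, Finset.mul_sum]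
  exact Finset.sum_congr rfl fun r _ => by ring

lemma flatKernel_zero : flatKernel (0 : (Fin ℓ → Torus d) → (Fin N → Torus d) → ℝ) = 0 := by
  funext y x
  simp [flatKernel]

lemma prod_trigMonomial_snoc (g : Fin ℓ → ℂ × (Fin d → ℤ)) (a : ℂ × (Fin d → ℤ))
    (y : Fin (ℓ + 1) → Torus d) :
    ∏ i, trigMonomial ((Fin.snoc g a : Fin (ℓ + 1) → ℂ × (Fin d → ℤ)) i) (y i) =
      (∏ i, trigMonomial (g i) (Fin.init y i)) * trigMonomial a (y (Fin.last ℓ)) := by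
  simp [Fin.prod_univ_castSucc, Fin.init]

/-- Substituting the new variable for `x r` moves the factor `h r` into the first group and leaves 1
in slot `r`. The class of kernels is therefore stable, with the same `N`. -/
lemma flatKernel_tensorKernel (g : Fin ℓ → ℂ × (Fin d → ℤ)) (h : Fin N → ℂ × (Fin d → ℤ)) :
    flatKernel (tensorKernel g h) = ∑ r, (tensorKernel
      (Fin.snoc g (h r) : Fin (ℓ + 1) → ℂ × (Fin d → ℤ)) (Function.update h r (1, 0)) -
        tensorKernel (Fin.snoc g (1, 0) : Fin (ℓ + 1) → ℂ × (Fin d → ℤ)) h) := by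
  funext y x
  simp only [flatKernel, Finset.sum_apply, Pi.sub_apply, tensorKernel, prod_trigMonomial_snoc,
    trigMonomial_one_zero, mul_one]
  refine Finset.sum_congr rfl fun r _ => ?_
  congr 1
  rw [mul_assoc]
  congr 1
  rw [← Finset.mul_prod_erase _ _ (Finset.mem_univ r),
    ← Finset.mul_prod_erase _ (fun r' => trigMonomial
      ((Function.update h r (1, 0) : Fin N → ℂ × (Fin d → ℤ)) r') (x r')) (Finset.mem_univ r)]
  simp only [Function.update_self, trigMonomial_one_zero, one_mul]
  congr 1
  refine Finset.prod_congr rfl fun r' hr' => ?_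
  rw [Function.update_of_ne (Finset.ne_of_mem_erase hr'),
    Function.update_of_ne (Finset.ne_of_mem_erase hr')]

lemma flatKernel_mem {K : (Fin ℓ → Torus d) → (Fin N → Torus d) → ℝ}
    (hK : K ∈ tensorSpan d ℓ N) : flatKernel K ∈ tensorSpan d (ℓ + 1) N := by
  refine tensorSpan_induction (P := fun K => flatKernel K ∈ tensorSpan d (ℓ + 1) N) ?_ ?_ ?_ ?_ hK
  · intro g h
    rw [flatKernel_tensorKernel]
    exact Submodule.sum_mem _ fun r _ =>
      Submodule.sub_mem _ (tensorKernel_mem _ _) (tensorKernel_mem _ _)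
  · rw [flatKernel_zero]; exact Submodule.zero_mem _
  · intro K _ K' _ h h'
    rw [flatKernel_add]; exact Submodule.add_mem _ h h'
  · intro c K _ h
    rw [flatKernel_smul]; exact Submodule.smul_mem _ c h

lemma polyFunctional_sum {ι : Type*} (S : Finset ι)
    {K : ι → (Fin ℓ → Torus d) → (Fin N → Torus d) → ℝ} (hK : ∀ r, K r ∈ tensorSpan d ℓ N)
    (m : ProbTorus d) (y : Fin ℓ → Torus d) :
    polyFunctional (∑ r ∈ S, K r) m y = ∑ r ∈ S, polyFunctional (K r) m y := by
  simp only [polyFunctional, Finset.sum_apply]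
  exact integral_finsetSum _ fun r _ =>
    (continuous_apply_of_mem_tensorSpan (hK r) y).integrable_of_compactSpace

lemma polyFunctional_sub {K K' : (Fin ℓ → Torus d) → (Fin N → Torus d) → ℝ}
    (hK : K ∈ tensorSpan d ℓ N) (hK' : K' ∈ tensorSpan d ℓ N) (m : ProbTorus d)
    (y : Fin ℓ → Torus d) :
    polyFunctional (K - K') m y = polyFunctional K m y - polyFunctional K' m y :=
  integral_sub (continuous_apply_of_mem_tensorSpan hK y).integrable_of_compactSpace
    (continuous_apply_of_mem_tensorSpan hK' y).integrable_of_compactSpace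

lemma polyFunctional_flatKernel_tensorKernel (g : Fin ℓ → ℂ × (Fin d → ℤ))
    (h : Fin N → ℂ × (Fin d → ℤ)) (m : ProbTorus d) (y : Fin ℓ → Torus d) (y' : Torus d) :
    polyFunctional (flatKernel (tensorKernel g h)) m (Fin.snoc y y' : Fin (ℓ + 1) → Torus d) =
      (∏ i, trigMonomial (g i) (y i)) *
        ∑ r, (trigMonomial (h r) y' - ∫ x, trigMonomial (h r) x ∂(m : Measure (Torus d))) *
          ∏ r' ∈ Finset.univ.erase r, ∫ x, trigMonomial (h r') x ∂(m : Measure (Torus d)) := by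
  rw [flatKernel_tensorKernel, polyFunctional_sum _ fun r =>
    Submodule.sub_mem _ (tensorKernel_mem _ _) (tensorKernel_mem _ _), Finset.mul_sum]
  refine Finset.sum_congr rfl fun r _ => ?_
  rw [polyFunctional_sub (tensorKernel_mem _ _) (tensorKernel_mem _ _),
    polyFunctional_tensorKernel, polyFunctional_tensorKernel, prod_trigMonomial_snoc,
    prod_trigMonomial_snoc, trigMonomial_one_zero, Fin.init_snoc, Fin.snoc_last,
    ← Finset.mul_prod_erase _ _ (Finset.mem_univ r),
    ← Finset.mul_prod_erase _ (fun r => ∫ x, trigMonomial (h r) x ∂(m : Measure (Torus d)))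
      (Finset.mem_univ r), Function.update_self]
  have e : ∏ r' ∈ Finset.univ.erase r, ∫ x, trigMonomial
      ((Function.update h r (1, 0) : Fin N → ℂ × (Fin d → ℤ)) r') x ∂(m : Measure (Torus d)) =
      ∏ r' ∈ Finset.univ.erase r, ∫ x, trigMonomial (h r') x ∂(m : Measure (Torus d)) :=
    Finset.prod_congr rfl fun r' hr' => by rw [Function.update_of_ne (Finset.ne_of_mem_erase hr')]
  rw [e]
  simp only [trigMonomial_one_zero, integral_const, probReal_univ, one_smul]
  ring

lemma integral_polyFunctional_flatKernel_tensorKernel (g : Fin ℓ → ℂ × (Fin d → ℤ))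
    (h : Fin N → ℂ × (Fin d → ℤ)) (m n : ProbTorus d) (y : Fin ℓ → Torus d) :
    ∫ y', polyFunctional (flatKernel (tensorKernel g h)) m (Fin.snoc y y' : Fin (ℓ + 1) → Torus d)
        ∂(n : Measure (Torus d)) =
      (∏ i, trigMonomial (g i) (y i)) *
        ∑ r, (∫ x, trigMonomial (h r) x ∂(n : Measure (Torus d)) -
          ∫ x, trigMonomial (h r) x ∂(m : Measure (Torus d))) *
          ∏ r' ∈ Finset.univ.erase r, ∫ x, trigMonomial (h r') x ∂(m : Measure (Torus d)) := by
  simp_rw [polyFunctional_flatKernel_tensorKernel]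
  rw [integral_const_mul, integral_finsetSum _ fun r _ =>
    Continuous.integrable_of_compactSpace (by fun_prop)]
  congr 1
  refine Finset.sum_congr rfl fun r _ => ?_
  rw [integral_mul_const, (continuous_trigMonomial (h r)).integral_sub_of_compactSpace
    continuous_const, integral_const, probReal_univ, one_smul]

lemma continuous_polyFunctional_snoc {K : (Fin (ℓ + 1) → Torus d) → (Fin N → Torus d) → ℝ}
    (hK : K ∈ tensorSpan d (ℓ + 1) N) (y : Fin ℓ → Torus d) :
    Continuous fun p : ProbTorus d × Torus d =>
      polyFunctional K p.1 (Fin.snoc y p.2 : Fin (ℓ + 1) → Torus d) :=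
  (continuous_polyFunctional hK).comp
    (continuous_fst.prodMk (continuous_const.finSnoc continuous_snd))

/-- For tensor products this is the product rule. The normalising term does not depend on `y'`, so
it cancels between the integrals against `m'` and `m`. -/
lemma isLinearDeriv_polyFunctional {K : (Fin ℓ → Torus d) → (Fin N → Torus d) → ℝ}
    (hK : K ∈ tensorSpan d ℓ N) (y : Fin ℓ → Torus d) :
    IsLinearDeriv (fun m => polyFunctional K m y)
      (fun m y' => polyFunctional (flatKernel K) m (Fin.snoc y y' : Fin (ℓ + 1) → Torus d)) := by
  refine tensorSpan_induction (P := fun K => IsLinearDeriv (fun m => polyFunctional K m y)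
      (fun m y' => polyFunctional (flatKernel K) m (Fin.snoc y y' : Fin (ℓ + 1) → Torus d)))
      ?_ ?_ ?_ ?_ hK
  · intro g h
    refine ⟨continuous_polyFunctional_snoc (flatKernel_mem (tensorKernel_mem g h)) y,
      fun m m' => ?_⟩
    simp_rw [integral_polyFunctional_flatKernel_tensorKernel, polyFunctional_tensorKernel,
      ← mul_sub, ← Finset.sum_sub_distrib, ← sub_mul, sub_sub_sub_cancel_right]
    rw [integral_const_mul, prod_sub_prod_eq_integral]
    simp_rw [integral_mixture _ m m' (continuous_trigMonomial _)]
  · simp only [flatKernel_zero, polyFunctional_zero]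
    exact ⟨continuous_const, fun m m' => by simp⟩
  · intro K hK K' hK' h h'
    simp only [flatKernel_add, polyFunctional_add hK hK',
      polyFunctional_add (flatKernel_mem hK) (flatKernel_mem hK')]
    exact h.add h'
  · intro c K hK h
    simp only [flatKernel_smul, polyFunctional_smul]
    exact h.const_mul c

lemma integral_polyFunctional_flatKernel {K : (Fin ℓ → Torus d) → (Fin N → Torus d) → ℝ}
    (hK : K ∈ tensorSpan d ℓ N) (m : ProbTorus d) (y : Fin ℓ → Torus d) :
    ∫ y', polyFunctional (flatKernel K) m (Fin.snoc y y' : Fin (ℓ + 1) → Torus d)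
      ∂(m : Measure (Torus d)) = 0 := by
  refine tensorSpan_induction (P := fun K => ∫ y', polyFunctional (flatKernel K) m
    (Fin.snoc y y' : Fin (ℓ + 1) → Torus d) ∂(m : Measure (Torus d)) = 0) ?_ ?_ ?_ ?_ hK
  · intro g h
    simp [integral_polyFunctional_flatKernel_tensorKernel]
  · simp [flatKernel_zero, polyFunctional_zero]
  · intro K hK K' hK' h h'
    simp only [flatKernel_add, polyFunctional_add (flatKernel_mem hK) (flatKernel_mem hK')]
    rw [integral_add, h, h', add_zero]
    · exact Continuous.integrable_of_compactSpace ((continuous_polyFunctional_snoc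
        (flatKernel_mem hK) y).comp (Continuous.prodMk_right m))
    · exact Continuous.integrable_of_compactSpace ((continuous_polyFunctional_snoc
        (flatKernel_mem hK') y).comp (Continuous.prodMk_right m))
  · intro c K hK h
    simp only [flatKernel_smul, polyFunctional_smul]
    rw [integral_const_mul, h, mul_zero]

/-- The kernels of the successive flat derivatives of the functional `m ↦ ∫ H dm^{⊗ N}`. -/
noncomputable def flatKernelSeq (H : (Fin N → Torus d) → ℝ) :
    (ℓ : ℕ) → (Fin ℓ → Torus d) → (Fin N → Torus d) → ℝ
  | 0 => fun _ => H
  | ℓ + 1 => flatKernel (flatKernelSeq H ℓ)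

variable (d N) in
/-- The real trigonometric polynomials on `(𝕋^d)^N`. -/
def IsTrigPolynomial (H : (Fin N → Torus d) → ℝ) : Prop :=
  (fun _ => H) ∈ tensorSpan d 0 N

variable {H : (Fin N → Torus d) → ℝ}

lemma flatKernelSeq_mem (hH : IsTrigPolynomial d N H) :
    ∀ ℓ, flatKernelSeq H ℓ ∈ tensorSpan d ℓ N
  | 0 => hH
  | ℓ + 1 => flatKernel_mem (flatKernelSeq_mem hH ℓ)

lemma isFlatDeriv_polyFunctional (hH : IsTrigPolynomial d N H) (k : ℕ) :
    IsFlatDeriv k (fun m : ProbTorus d => ∫ x, H x ∂Measure.pi fun _ => (m : Measure (Torus d)))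
      fun ℓ => polyFunctional (flatKernelSeq H ℓ) where
  zero _ _ := rfl
  continuous ℓ _ := continuous_polyFunctional (flatKernelSeq_mem hH ℓ)
  sub_eq_integral ℓ _ m m' y := (isLinearDeriv_polyFunctional (flatKernelSeq_mem hH ℓ) y).sub_eq m m'
  integral_eq_zero ℓ _ m y := integral_polyFunctional_flatKernel (flatKernelSeq_mem hH ℓ) m y

lemma finite_setOf_admissible (d ℓ n : ℕ) :
    {β : Fin ℓ → Fin d → ℕ | Admissible n β}.Finite := by
  refine (Set.finite_Iic (fun _ _ => n : Fin ℓ → Fin d → ℕ)).subset fun β hβ i j => ?_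
  exact (Finset.single_le_sum (f := β i) (fun _ _ => Nat.zero_le _) (Finset.mem_univ j)).trans
    (hβ i)

/-- Every crossed derivative is jointly continuous on a compact space, hence bounded, and only
finitely many `ℓ` and `β` occur for given `n`, `k`. -/
lemma smoothFunctional_integral_pi (hH : IsTrigPolynomial d N H) :
    SmoothFunctional fun m : ProbTorus d =>
      ∫ x, H x ∂Measure.pi fun _ => (m : Measure (Torus d)) := by
  intro n k
  choose D hD hDc using fun ℓ => exists_isCrossedDeriv_polyFunctional (flatKernelSeq_mem hH ℓ)
  choose B hB using fun ℓ β => (hDc ℓ β).exists_abs_le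
  have hfin : ∀ ℓ, ∃ C, ∀ β, Admissible n β → B ℓ β ≤ C := fun ℓ => by
    obtain ⟨C, hC⟩ := ((finite_setOf_admissible d ℓ n).image (B ℓ)).bddAbove
    exact ⟨C, fun β hβ => hC ⟨β, hβ, rfl⟩⟩
  choose E hE using hfin
  obtain ⟨C, hC⟩ := ((Set.finite_Iic k).image E).bddAbove
  refine ⟨C, _, isFlatDeriv_polyFunctional hH k, fun ℓ hℓ =>
    ⟨D ℓ, hD ℓ _, fun β hβ => ⟨fun m y => ?_, ?_, ?_⟩⟩⟩
  · rw [Nat.floor_natCast] at hβ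
    exact (hB ℓ β (m, y)).trans ((hE ℓ β hβ).trans (hC ⟨ℓ, hℓ, rfl⟩))
  · exact (hDc ℓ β).uniformEquicontinuous_of_compactSpace
  -- The order is an integer, so the Hölder clause is vacuous.
  · simp

/-- As `α < 1`, only `β = 0` is admissible: the family `D` may be constant in `β`, and no derivative
condition remains. -/
lemma intPhiBound_integral_pi (hH : IsTrigPolynomial d N H) {α : ℝ} (hα1 : α < 1)
    {k : ℕ} {C : ℝ} (hC : ∀ ℓ ≤ k, ∀ m y, |polyFunctional (flatKernelSeq H ℓ) m y| ≤ C)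
    (hα : 0 < α → ∀ ℓ ≤ k, ∀ m y z, |polyFunctional (flatKernelSeq H ℓ) m y -
      polyFunctional (flatKernelSeq H ℓ) m z| ≤ C * dist y z ^ α) :
    IntPhiBound α k C
      fun m : ProbTorus d => ∫ x, H x ∂Measure.pi fun _ => (m : Measure (Torus d)) := by
  have hfl : ⌊α⌋₊ = 0 := Nat.floor_eq_zero.2 hα1
  refine ⟨_, isFlatDeriv_polyFunctional hH k, fun ℓ hℓ =>
    ⟨fun _ => polyFunctional (flatKernelSeq H ℓ), fun m => ⟨rfl, fun _ _ => ?_, ?_⟩,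
      fun β _ => ⟨hC ℓ hℓ, ?_, ?_⟩⟩⟩
  · exact (continuous_polyFunctional (flatKernelSeq_mem hH ℓ)).comp (Continuous.prodMk_right m)
  · intro β i j hβ
    have h := hβ i
    rw [hfl] at h
    have h' := (Finset.single_le_sum (f := (β + Pi.single i (Pi.single j 1) : Fin ℓ → Fin d → ℕ) i)
      (fun _ _ => Nat.zero_le _) (Finset.mem_univ j)).trans h
    simp at h'
  · exact (continuous_polyFunctional
      (flatKernelSeq_mem hH ℓ)).uniformEquicontinuous_of_compactSpace
  · simpa only [hfl, Nat.cast_zero, sub_zero] using fun h => hα h ℓ hℓ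

end FlatKernel

/-! ### Finite differences and bounds independent of `N` -/

section Differences

variable {d N : ℕ}

/-- First and mixed second differences of `F` are controlled by `w` with the scaling of a function
of an average of `N` terms. -/
structure HasDiffBound (F : (Fin N → Torus d) → ℝ) (w : Torus d → Torus d → ℝ) : Prop where
  first : ∀ x i a a', |F (Function.update x i a) - F (Function.update x i a')| ≤
    (N : ℝ)⁻¹ * w a a'
  second : ∀ x i j, i ≠ j → ∀ a a' b b',
    |(F (Function.update (Function.update x j b) i a) -
        F (Function.update (Function.update x j b) i a')) -
      (F (Function.update (Function.update x j b') i a) -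
        F (Function.update (Function.update x j b') i a'))| ≤
      (N : ℝ)⁻¹ * ((N : ℝ)⁻¹ * (2 * w a a'))

/-- The factor 2 in the mixed bound comes from using the modulus of `U₂` in its first variable once
at `b` and once at `b'`. -/
lemma hasDiffBound_empiricalMeasure [NeZero N] {U : ProbTorus d → ℝ}
    {U₁ : ProbTorus d → Torus d → ℝ} {U₂ : ProbTorus d → Torus d → Torus d → ℝ}
    (h₁ : IsLinearDeriv U U₁) (h₂ : ∀ a, IsLinearDeriv (fun m => U₁ m a) fun m => U₂ m a)
    {w : Torus d → Torus d → ℝ} (hw₁ : ∀ n a a', |U₁ n a - U₁ n a'| ≤ w a a')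
    (hw₂ : ∀ n a a' b, |U₂ n a b - U₂ n a' b| ≤ w a a') :
    HasDiffBound (fun z : Fin N → Torus d => U (empiricalMeasure z)) w where
  first x i a a' := by
    simp only [empiricalMeasure_update]
    exact h₁.abs_averageMeasure_update_diracProba_sub_le _ i fun n => hw₁ n a a'
  second x i j hij a a' b b' := by
    have e : ∀ c, (fun k => diracProba (Function.update x j c k)) =
        Function.update (fun k => diracProba (x k)) j (diracProba c) := fun c => by
      funext k
      exact Function.apply_update (fun _ => diracProba) x j c k
    simp only [empiricalMeasure_update, e]
    refine abs_second_difference_averageMeasure_le h₁ h₂ _ hij fun n => ?_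
    have e1 := hw₂ n a a' b
    have e2 := hw₂ n a a' b'
    rw [abs_le] at *
    constructor <;> linarith

/-- Updating a slot commutes with translation up to translating the new value, so an invariant
weight `w` is preserved by averaging over translates. -/
lemma HasDiffBound.integral_add {F : (Fin N → Torus d) → ℝ} {w : Torus d → Torus d → ℝ}
    (hF : Continuous F) (h : HasDiffBound F w) (hw : ∀ a a' c, w (a + c) (a' + c) = w a a')
    (Q : Measure (Fin N → Torus d)) [IsProbabilityMeasure Q] :
    HasDiffBound (fun x => ∫ z, F (x + z) ∂Q) w := by
  have hc : ∀ x, Continuous fun z => F (x + z) := fun x => by fun_prop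
  have e : ∀ (x z : Fin N → Torus d) i a,
      Function.update x i a + z = Function.update (x + z) i (a + z i) := fun x z i a => by
    funext k
    by_cases hk : k = i
    · subst hk; simp
    · simp [Function.update_of_ne hk]
  refine ⟨fun x i a a' => ?_, fun x i j hij a a' b b' => ?_⟩
  · rw [← (hc _).integral_sub_of_compactSpace (hc _)]
    refine abs_integral_le_of_abs_le _ fun z => ?_
    rw [e, e, ← hw a a' (z i)]
    exact h.first _ _ _ _
  · rw [← (hc _).integral_sub_of_compactSpace (hc _), ← (hc _).integral_sub_of_compactSpace (hc _),
      ← Continuous.integral_sub_of_compactSpace ?_ ?_]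
    · refine abs_integral_le_of_abs_le _ fun z => ?_
      simp only [e]
      rw [← hw a a' (z i)]
      exact h.second _ i j hij _ _ _ _
    · fun_prop
    · fun_prop

/-- The mixed second difference at the coordinates `i`, `j`, relative to the point `x`. -/
noncomputable def mixedDiff (F : (Fin N → Torus d) → ℝ) (x : Fin N → Torus d) (i j : Fin N)
    (a b : Torus d) : ℝ :=
  (F (Function.update (Function.update x j b) i a) - F (Function.update x j b)) -
    (F (Function.update x i a) - F x)

variable {F : (Fin N → Torus d) → ℝ} {w : Torus d → Torus d → ℝ}

lemma mixedDiff_self (x : Fin N → Torus d) (i : Fin N) (a b : Torus d) :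
    mixedDiff F x i i a b = F x - F (Function.update x i b) := by
  simp only [mixedDiff, Function.update_idem]
  ring

/-- Off the diagonal, `a` and then `b` are changed, each at cost `2w/N²`. On the diagonal the second
update overwrites the first, and only one first difference, of size `w/N`, is left. -/
lemma HasDiffBound.abs_mixedDiff_sub_le (h : HasDiffBound F w) (hw : ∀ a a', 0 ≤ w a a')
    (x : Fin N → Torus d) (i j : Fin N) (a a' b b' : Torus d) :
    |mixedDiff F x i j a b - mixedDiff F x i j a' b'| ≤
      (N : ℝ)⁻¹ * ((N : ℝ)⁻¹ * (2 * w a a' + 2 * w b b')) +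
        if i = j then (N : ℝ)⁻¹ * w b b' else 0 := by
  by_cases hij : i = j
  · subst hij
    rw [mixedDiff_self, mixedDiff_self, if_pos rfl]
    have h1 := h.first x i b b'
    have h2 : 0 ≤ (N : ℝ)⁻¹ * ((N : ℝ)⁻¹ * (2 * w a a' + 2 * w b b')) := by
      have := hw a a'
      have := hw b b'
      positivity
    rw [abs_le] at *
    constructor <;> linarith
  -- Taking `x j` and `x i` as reference values turns the second differences into increments of
  -- `mixedDiff` based at `x`.
  · have h1 := h.second x i j hij a a' b (x j)
    have h2 := h.second x j i (Ne.symm hij) b b' a' (x i)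
    simp only [Function.update_eq_self] at h1 h2
    have e : ∀ c, Function.update (Function.update x i a') j c =
        Function.update (Function.update x j c) i a' := fun c => Function.update_comm hij a' c x
    rw [e, e] at h2
    rw [if_neg hij, add_zero, mul_add, mul_add]
    simp only [mixedDiff]
    rw [abs_le] at *
    constructor <;> linarith

lemma flatKernelSeq_one (F : (Fin N → Torus d) → ℝ) (y : Fin 1 → Torus d) (x : Fin N → Torus d) :
    flatKernelSeq F 1 y x = ∑ i, (F (Function.update x i (y 0)) - F x) := rfl

lemma flatKernelSeq_two (F : (Fin N → Torus d) → ℝ) (y : Fin 2 → Torus d) (x : Fin N → Torus d) :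
    flatKernelSeq F 2 y x = ∑ j, ∑ i, mixedDiff F x i j (y 0) (y 1) := by
  simp only [mixedDiff, Finset.sum_sub_distrib (fun i => _ - _)]
  rfl

lemma HasDiffBound.abs_flatKernelSeq_one_sub_le [NeZero N] (h : HasDiffBound F w)
    (y y' : Fin 1 → Torus d) (x : Fin N → Torus d) :
    |flatKernelSeq F 1 y x - flatKernelSeq F 1 y' x| ≤ w (y 0) (y' 0) := by
  rw [flatKernelSeq_one, flatKernelSeq_one, ← Finset.sum_sub_distrib]
  refine (Finset.abs_sum_le_sum_abs _ _).trans ((Finset.sum_le_sum fun i _ => ?_).trans_eq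
    (?_ : ∑ _i : Fin N, (N : ℝ)⁻¹ * w (y 0) (y' 0) = _))
  · rw [sub_sub_sub_cancel_right]
    exact h.first x i _ _
  · simp [NeZero.ne N]

lemma HasDiffBound.abs_flatKernelSeq_one_le [NeZero N] (h : HasDiffBound F w) {W : ℝ}
    (hW : ∀ a a', w a a' ≤ W) (y : Fin 1 → Torus d) (x : Fin N → Torus d) :
    |flatKernelSeq F 1 y x| ≤ W := by
  rw [flatKernelSeq_one]
  refine (Finset.abs_sum_le_sum_abs _ _).trans ((Finset.sum_le_sum fun i _ => ?_).trans_eq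
    (?_ : ∑ _i : Fin N, (N : ℝ)⁻¹ * W = _))
  · have e := h.first x i (y 0) (x i)
    rw [Function.update_eq_self] at e
    refine e.trans ?_
    gcongr
    exact hW _ _
  · simp [NeZero.ne N]

lemma sum_sum_diag [NeZero N] (A B : ℝ) :
    ∑ j : Fin N, ∑ i : Fin N, ((N : ℝ)⁻¹ * ((N : ℝ)⁻¹ * A) + if i = j then (N : ℝ)⁻¹ * B else 0) =
      A + B := by
  have hN : (N : ℝ) ≠ 0 := Nat.cast_ne_zero.2 (NeZero.ne N)
  simp [Finset.sum_add_distrib, mul_inv_cancel_left₀ hN]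

lemma HasDiffBound.abs_flatKernelSeq_two_sub_le [NeZero N] (h : HasDiffBound F w)
    (hw : ∀ a a', 0 ≤ w a a') (y y' : Fin 2 → Torus d) (x : Fin N → Torus d) :
    |flatKernelSeq F 2 y x - flatKernelSeq F 2 y' x| ≤
      2 * w (y 0) (y' 0) + 3 * w (y 1) (y' 1) := by
  rw [flatKernelSeq_two, flatKernelSeq_two, ← Finset.sum_sub_distrib]
  simp only [← Finset.sum_sub_distrib]
  refine (Finset.abs_sum_le_sum_abs _ _).trans ((Finset.sum_le_sum fun j _ =>
    (Finset.abs_sum_le_sum_abs _ _).trans (Finset.sum_le_sum fun i _ =>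
      h.abs_mixedDiff_sub_le hw x i j _ _ _ _)).trans_eq ?_)
  rw [sum_sum_diag]
  ring

lemma HasDiffBound.abs_flatKernelSeq_two_le [NeZero N] (h : HasDiffBound F w)
    (hw : ∀ a a', 0 ≤ w a a') {W : ℝ} (hW : ∀ a a', w a a' ≤ W)
    (y : Fin 2 → Torus d) (x : Fin N → Torus d) : |flatKernelSeq F 2 y x| ≤ 5 * W := by
  rw [flatKernelSeq_two]
  refine (Finset.abs_sum_le_sum_abs _ _).trans ((Finset.sum_le_sum fun j _ =>
    (Finset.abs_sum_le_sum_abs _ _).trans (Finset.sum_le_sum fun i _ => (?_ :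
      _ ≤ (N : ℝ)⁻¹ * ((N : ℝ)⁻¹ * (4 * W)) + if i = j then (N : ℝ)⁻¹ * W else 0))).trans_eq ?_)
  -- The comparison point `(x i, x j)` makes the mixed difference vanish, so the oscillation bound
  -- becomes a sup bound.
  · have e := h.abs_mixedDiff_sub_le hw x i j (y 0) (x i) (y 1) (x j)
    have e0 : mixedDiff F x i j (x i) (x j) = 0 := by simp [mixedDiff]
    rw [e0, sub_zero] at e
    refine e.trans ?_
    have h1 := hW (y 0) (x i)
    have h2 := hW (y 1) (x j)
    have h3 : (if i = j then (N : ℝ)⁻¹ * w (y 1) (x j) else 0) ≤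
        if i = j then (N : ℝ)⁻¹ * W else 0 := by
      split_ifs
      · gcongr
      · exact le_rfl
    gcongr ?_ + ?_
    gcongr
    linarith
  · rw [sum_sum_diag]
    ring

lemma polyFunctional_sub_le {ℓ : ℕ} {K : (Fin ℓ → Torus d) → (Fin N → Torus d) → ℝ}
    (hK : K ∈ tensorSpan d ℓ N) {y y' : Fin ℓ → Torus d} {B : ℝ} (hB : ∀ x, |K y x - K y' x| ≤ B)
    (m : ProbTorus d) : |polyFunctional K m y - polyFunctional K m y'| ≤ B := by
  unfold polyFunctional
  rw [← (continuous_apply_of_mem_tensorSpan hK y).integral_sub_of_compactSpace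
    (continuous_apply_of_mem_tensorSpan hK y')]
  exact abs_integral_le_of_abs_le _ hB

/-- The second-order sup bound is `5W` with `W = 2C`, whence `10 C`; the Hölder constants are at
most `2C + 3C`. -/
lemma intPhiBound_of_hasDiffBound [NeZero N] {H : (Fin N → Torus d) → ℝ}
    (hH : IsTrigPolynomial d N H) {α : ℝ} (hα1 : α < 1) {C : ℝ} (hC : 0 ≤ C)
    (hHC : ∀ x, |H x| ≤ C) (hb : HasDiffBound H fun _ _ => 2 * C)
    (hα : 0 < α → HasDiffBound H fun a a' => C * dist a a' ^ α) :
    IntPhiBound α 2 (10 * C)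
      fun m : ProbTorus d => ∫ x, H x ∂Measure.pi fun _ => (m : Measure (Torus d)) := by
  refine intPhiBound_integral_pi hH hα1 (fun ℓ hℓ m y => ?_) fun h0 ℓ hℓ m y z => ?_
  · refine abs_integral_le_of_abs_le _ fun x => ?_
    interval_cases ℓ
    · exact (hHC x).trans (by linarith)
    · exact (hb.abs_flatKernelSeq_one_le (fun _ _ => le_rfl) y x).trans (by linarith)
    · exact (hb.abs_flatKernelSeq_two_le (fun _ _ => by positivity)
        (fun _ _ => le_rfl) y x).trans_eq (by ring)
  · refine polyFunctional_sub_le (flatKernelSeq_mem hH ℓ) (fun x => ?_) m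
    have hd : ∀ i, C * dist (y i) (z i) ^ α ≤ C * dist y z ^ α := fun i => by
      gcongr
      exact dist_le_pi_dist y z i
    have hp : 0 ≤ C * dist y z ^ α := by positivity
    interval_cases ℓ
    · simp only [flatKernelSeq, sub_self, abs_zero]
      positivity
    · refine ((hα h0).abs_flatKernelSeq_one_sub_le y z x).trans ((hd 0).trans ?_)
      linarith
    · refine ((hα h0).abs_flatKernelSeq_two_sub_le (fun _ _ => by positivity) y z x).trans ?_
      have h1 := hd 0
      have h2 := hd 1
      linarith

end Differences

/-! ### Trigonometric approximate identity -/

section SmoothingKernel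

variable {d : ℕ}

lemma mFourier_sub (k : Fin d → ℤ) (z x : Torus d) :
    UnitAddTorus.mFourier k (z - x) =
      UnitAddTorus.mFourier k z * (starRingEnd ℂ) (UnitAddTorus.mFourier k x) := by
  simp only [UnitAddTorus.mFourier, ContinuousMap.coe_mk, map_prod, ← Finset.prod_mul_distrib]
  refine Finset.prod_congr rfl fun i _ => ?_
  rw [← fourier_neg, fourier_apply, fourier_apply, fourier_apply, Pi.sub_apply, smul_sub, neg_smul,
    sub_eq_add_neg, AddCircle.toCircle_add, Circle.coe_mul]

/-- The translates of `ρ` are trigonometric polynomials in the translation vector. -/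
def IsTrigSeparable (ρ : Torus d → ℝ) : Prop :=
  ∃ (S : Finset ((Fin d → ℤ) × Bool)) (a : (Fin d → ℤ) × Bool → ℂ × (Fin d → ℤ))
    (c : (Fin d → ℤ) × Bool → Torus d → ℝ), (∀ s, Continuous (c s)) ∧
    ∀ z x, ρ (z - x) = ∑ s ∈ S, c s z * trigMonomial (a s) x

lemma isTrigSeparable_re {f : C(Torus d, ℂ)} (hf : f ∈ UnitAddTorus.mFourierSubalgebra (Fin d)) :
    IsTrigSeparable fun x => (f x).re := by
  have hf' : f ∈ Submodule.span ℂ (Set.range (UnitAddTorus.mFourier (d := Fin d))) := by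
    rw [← UnitAddTorus.mFourierSubalgebra_coe]
    exact hf
  obtain ⟨b, rfl⟩ := (Finsupp.mem_span_range_iff_exists_finsupp).1 hf'
  -- From `Re (A conj B) = Re A Re B + Im A Im B`: the Boolean selects the real or the imaginary
  -- part, the latter through `Im B = Re (-i B)`.
  refine ⟨b.support ×ˢ Finset.univ, fun s => (if s.2 then 1 else -Complex.I, s.1),
    fun s z => if s.2 then (b s.1 * UnitAddTorus.mFourier s.1 z).re
      else (b s.1 * UnitAddTorus.mFourier s.1 z).im, fun s => ?_, fun z x => ?_⟩
  · dsimp only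
    split_ifs
    · exact Complex.continuous_re.comp (by fun_prop)
    · exact Complex.continuous_im.comp (by fun_prop)
  · rw [Finset.sum_product]
    simp only [Finsupp.sum, ContinuousMap.coe_sum, Finset.sum_apply, ContinuousMap.coe_smul,
      Pi.smul_apply, smul_eq_mul, Complex.re_sum, Fintype.sum_bool, if_true, mFourier_sub]
    refine Finset.sum_congr rfl fun k _ => ?_
    simp [trigMonomial]
    ring

lemma IsTrigSeparable.const_mul {ρ : Torus d → ℝ} (h : IsTrigSeparable ρ) (r : ℝ) :
    IsTrigSeparable fun x => r * ρ x := by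
  obtain ⟨S, a, c, hc, h⟩ := h
  exact ⟨S, a, fun s z => r * c s z, fun s => continuous_const.mul (hc s), fun z x => by
    simp only [h, Finset.mul_sum, mul_assoc]⟩

/-- A trigonometric polynomial on the torus with a strict maximum at the origin. -/
noncomputable def peakPolynomial (d : ℕ) : C(Torus d, ℂ) :=
  (∏ j, (1 + UnitAddTorus.mFourier (Pi.single j 1))) *
    star (∏ j, (1 + UnitAddTorus.mFourier (Pi.single j 1)))

/-- The real values of `peakPolynomial`. -/
noncomputable def peakFunction (x : Torus d) : ℝ := ∏ j, ‖1 + fourier 1 (x j)‖ ^ 2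

lemma peakPolynomial_mem : peakPolynomial d ∈ UnitAddTorus.mFourierSubalgebra (Fin d) := by
  have h : ∏ j : Fin d, (1 + UnitAddTorus.mFourier (Pi.single j 1)) ∈
      UnitAddTorus.mFourierSubalgebra (Fin d) :=
    prod_mem fun j _ => add_mem (one_mem _) (Algebra.subset_adjoin ⟨_, rfl⟩)
  exact mul_mem h (star_mem h)

lemma peakPolynomial_apply (x : Torus d) : peakPolynomial d x = (peakFunction x : ℂ) := by
  simp only [peakPolynomial, peakFunction, ContinuousMap.mul_apply, ContinuousMap.star_apply,
    ContinuousMap.coe_prod, Finset.prod_apply, ContinuousMap.add_apply, ContinuousMap.one_apply,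
    UnitAddTorus.mFourier_single, star_prod, ← Finset.prod_mul_distrib, Complex.ofReal_prod,
    Complex.ofReal_pow]
  exact Finset.prod_congr rfl fun j _ => Complex.mul_conj' _

lemma continuous_peakFunction : Continuous (peakFunction (d := d)) := by
  unfold peakFunction
  fun_prop

lemma peakFunction_nonneg (x : Torus d) : 0 ≤ peakFunction x :=
  Finset.prod_nonneg fun _ _ => by positivity

lemma norm_one_add_fourier_le (t : UnitAddCircle) : ‖1 + fourier 1 t‖ ≤ 2 := by
  refine (norm_add_le _ _).trans ?_
  rw [fourier_one, Circle.norm_coe, norm_one]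
  norm_num

/-- Equality in the triangle inequality puts two unit vectors on one ray, hence makes them equal. -/
lemma norm_one_add_fourier_lt {t : UnitAddCircle} (ht : t ≠ 0) : ‖1 + fourier 1 t‖ < 2 := by
  refine lt_of_le_of_ne (norm_one_add_fourier_le t) fun h => ht ?_
  have h1 : ‖(1 : ℂ) + AddCircle.toCircle t‖ = ‖(1 : ℂ)‖ + ‖(AddCircle.toCircle t : ℂ)‖ := by
    rw [← fourier_one, h, fourier_one, Circle.norm_coe, norm_one]
    norm_num
  have h2 := (sameRay_iff_norm_add.2 h1).norm_smul_eq
  rw [Circle.norm_coe, norm_one, one_smul, one_smul] at h2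
  refine AddCircle.injective_toCircle one_ne_zero (Circle.ext ?_)
  rw [h2, AddCircle.toCircle_zero, Circle.coe_one]

lemma peakFunction_zero : peakFunction (0 : Torus d) = ∏ _j : Fin d, 4 := by
  refine Finset.prod_congr rfl fun j _ => ?_
  rw [Pi.zero_apply, fourier_eval_zero]
  norm_num

lemma peakFunction_lt {x : Torus d} (hx : x ≠ 0) : peakFunction x < peakFunction (0 : Torus d) := by
  rw [peakFunction_zero]
  obtain ⟨j, hj⟩ := Function.ne_iff.1 hx
  -- Strict comparison of products needs positive factors; if one factor vanishes, so does the whole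
  -- product.
  by_cases h0 : ∀ i, 0 < ‖1 + fourier 1 (x i)‖ ^ 2
  · refine Finset.prod_lt_prod (fun i _ => h0 i) (fun i _ => ?_) ⟨j, Finset.mem_univ j, ?_⟩
    · nlinarith [norm_one_add_fourier_le (x i), norm_nonneg (1 + fourier 1 (x i))]
    · nlinarith [norm_one_add_fourier_lt hj, norm_nonneg (1 + fourier 1 (x j))]
  · push Not at h0
    obtain ⟨i, hi⟩ := h0
    have : peakFunction x = 0 :=
      Finset.prod_eq_zero (Finset.mem_univ i) (le_antisymm hi (by positivity))
    rw [this]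
    positivity

/-- A probability density on the torus whose translates are trigonometric polynomials. -/
structure IsTrigDensity (ρ : Torus d → ℝ) : Prop where
  continuous : Continuous ρ
  nonneg : ∀ x, 0 ≤ ρ x
  integral_eq_one : ∫ x, ρ x = 1
  separable : IsTrigSeparable ρ

/-- Normalised powers of a nonnegative function concentrate at its unique maximum, here the origin,
so the mean of `‖x‖` tends to its value there. -/
lemma exists_isTrigDensity_tendsto (d : ℕ) : ∃ ρ : ℕ → Torus d → ℝ, (∀ n, IsTrigDensity (ρ n)) ∧
    Tendsto (fun n => ∫ x, ‖x‖ * ρ n x) atTop (𝓝 0) := by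
  have hpos : ∀ n : ℕ, 0 < ∫ x : Torus d, peakFunction x ^ n := fun n =>
    (continuous_peakFunction.pow n).integral_pos_of_hasCompactSupport_nonneg_nonzero (x := 0)
      (HasCompactSupport.of_compactSpace _) (fun x => pow_nonneg (peakFunction_nonneg x) n)
      (pow_ne_zero _ (by rw [peakFunction_zero]; positivity))
  refine ⟨fun n x => (∫ x : Torus d, peakFunction x ^ n)⁻¹ * peakFunction x ^ n,
    fun n => ⟨continuous_const.mul (continuous_peakFunction.pow n), fun x =>
      mul_nonneg (inv_nonneg.2 (hpos n).le) (pow_nonneg (peakFunction_nonneg x) n), ?_, ?_⟩, ?_⟩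
  · rw [integral_const_mul, inv_mul_cancel₀ (hpos n).ne']
  · refine IsTrigSeparable.const_mul ?_ _
    have h := isTrigSeparable_re (pow_mem (peakPolynomial_mem (d := d)) n)
    simpa only [ContinuousMap.pow_apply, peakPolynomial_apply, ← Complex.ofReal_pow,
      Complex.ofReal_re] using h
  · have h := tendsto_setIntegral_pow_smul_of_unique_maximum_of_isCompact_of_continuousOn
      (μ := (volume : Measure (Torus d))) (g := fun x : Torus d => ‖x‖) (x₀ := 0) isCompact_univ
      continuous_peakFunction.continuousOn (fun y _ hy => peakFunction_lt hy)
      (fun x _ => peakFunction_nonneg x) (by rw [peakFunction_zero]; positivity) (by simp)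
      continuous_norm.continuousOn
    simp only [Measure.restrict_univ, smul_eq_mul, norm_zero] at h
    refine h.congr fun n => ?_
    rw [← integral_const_mul]
    exact integral_congr_ae (Eventually.of_forall fun x => by simp only; ring)

end SmoothingKernel

/-! ### Smoothing by a trigonometric density -/

section Smoothing

variable {d N : ℕ}

instance Torus.instIsAddHaarMeasurePi (d N : ℕ) :
    Measure.IsAddHaarMeasure (volume : Measure (Fin N → Torus d)) :=
  Measure.pi.isAddHaarMeasure fun _ : Fin N => (volume : Measure (Torus d))

variable (N) in
/-- The law of `N` independent points with density `ρ`. -/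
noncomputable def smoothingLaw (ρ : Torus d → ℝ) : Measure (Fin N → Torus d) :=
  volume.withDensity fun z => (Real.toNNReal (∏ i, ρ (z i)) : ENNReal)

variable {ρ : Torus d → ℝ}

lemma IsTrigDensity.continuous_prod (hρ : IsTrigDensity ρ) :
    Continuous fun z : Fin N → Torus d => ∏ i, ρ (z i) :=
  continuous_finsetProd _ fun i _ => hρ.continuous.comp (continuous_apply i)

lemma IsTrigDensity.prod_nonneg (hρ : IsTrigDensity ρ) (z : Fin N → Torus d) :
    0 ≤ ∏ i, ρ (z i) :=
  Finset.prod_nonneg fun _ _ => hρ.nonneg _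

lemma IsTrigDensity.integral_smoothingLaw (hρ : IsTrigDensity ρ) (f : (Fin N → Torus d) → ℝ) :
    ∫ z, f z ∂smoothingLaw N ρ = ∫ z : Fin N → Torus d, (∏ i, ρ (z i)) * f z := by
  unfold smoothingLaw
  rw [integral_withDensity_eq_integral_smul hρ.continuous_prod.measurable.real_toNNReal]
  refine integral_congr_ae (Eventually.of_forall fun z => ?_)
  simp only [NNReal.smul_def, Real.coe_toNNReal _ (hρ.prod_nonneg z), smul_eq_mul]

lemma IsTrigDensity.isProbabilityMeasure (hρ : IsTrigDensity ρ) :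
    IsProbabilityMeasure (smoothingLaw N ρ) := by
  refine ⟨?_⟩
  unfold smoothingLaw
  rw [withDensity_apply _ MeasurableSet.univ, Measure.restrict_univ]
  change ∫⁻ z : Fin N → Torus d, ENNReal.ofReal (∏ i, ρ (z i)) = 1
  rw [← ofReal_integral_eq_lintegral_ofReal hρ.continuous_prod.integrable_of_compactSpace
    (Eventually.of_forall hρ.prod_nonneg), integral_fintype_prod_volume_eq_prod (fun _ => ρ)]
  simp [hρ.integral_eq_one]

lemma IsTrigDensity.integral_comp_apply (hρ : IsTrigDensity ρ) (f : Torus d → ℝ) (i : Fin N) :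
    ∫ z, f (z i) ∂smoothingLaw N ρ = ∫ x, f x * ρ x := by
  rw [hρ.integral_smoothingLaw]
  have e : ∀ z : Fin N → Torus d, (∏ j, ρ (z j)) * f (z i) =
      ∏ j, Function.update (fun _ => ρ) i (fun x => f x * ρ x) j (z j) := fun z => by
    rw [← Finset.mul_prod_erase _ _ (Finset.mem_univ i),
      ← Finset.mul_prod_erase _ (fun j => Function.update (fun _ => ρ) i (fun x => f x * ρ x) j (z j))
        (Finset.mem_univ i), Function.update_self]
    have : ∏ j ∈ Finset.univ.erase i, Function.update (fun _ => ρ) i (fun x => f x * ρ x) j (z j) =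
        ∏ j ∈ Finset.univ.erase i, ρ (z j) :=
      Finset.prod_congr rfl fun j hj => by rw [Function.update_of_ne (Finset.ne_of_mem_erase hj)]
    rw [this]
    ring
  simp_rw [e]
  rw [integral_fintype_prod_volume_eq_prod, Finset.prod_eq_single i]
  · rw [Function.update_self]
  · intro j _ hj
    rw [Function.update_of_ne hj, hρ.integral_eq_one]
  · simp

/-- Translation invariance of Haar measure moves `x` from `F` into the density. Expanding the
product of the separated densities leaves trigonometric monomials in `x`, with `F` entering only the
coefficients. -/
lemma IsTrigDensity.isTrigPolynomial_integral (hρ : IsTrigDensity ρ) {F : (Fin N → Torus d) → ℝ}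
    (hF : Continuous F) : IsTrigPolynomial d N fun x => ∫ z, F (x + z) ∂smoothingLaw N ρ := by
  obtain ⟨S, a, c, hc, h⟩ := hρ.separable
  have e : (fun (_ : Fin 0 → Torus d) x => ∫ z, F (x + z) ∂smoothingLaw N ρ) =
      ∑ p ∈ Fintype.piFinset fun _ : Fin N => S,
        (∫ z : Fin N → Torus d, F z * ∏ i, c (p i) (z i)) •
          tensorKernel (Fin.elim0 : Fin 0 → ℂ × (Fin d → ℤ)) (fun i => a (p i)) := by
    funext y x
    rw [hρ.integral_smoothingLaw, ← integral_sub_right_eq_self _ x]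
    have e1 : ∀ z : Fin N → Torus d, (∏ i, ρ ((z - x) i)) * F (x + (z - x)) =
        ∑ p ∈ Fintype.piFinset fun _ : Fin N => S,
          (F z * ∏ i, c (p i) (z i)) * ∏ i, trigMonomial (a (p i)) (x i) := fun z => by
      simp only [Pi.sub_apply, h, Finset.prod_univ_sum, Finset.prod_mul_distrib, Finset.sum_mul,
        add_sub_cancel]
      exact Finset.sum_congr rfl fun p _ => by ring
    simp_rw [e1]
    rw [integral_finsetSum _ fun p _ => Continuous.integrable_of_compactSpace (by fun_prop)]
    simp only [integral_mul_const, Finset.sum_apply, Pi.smul_apply, smul_eq_mul, tensorKernel,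
      Finset.univ_eq_empty, Finset.prod_empty, one_mul]
  unfold IsTrigPolynomial
  rw [e]
  exact Submodule.sum_mem _ fun p _ => Submodule.smul_mem _ _ (tensorKernel_mem _ _)

end Smoothing

/-! ### Distance between the smoothed functional and the original -/

section Approximation

variable {d N : ℕ} {U : ProbTorus d → ℝ} {U₁ : ProbTorus d → Torus d → ℝ}
  {U₂ : ProbTorus d → Torus d → Torus d → ℝ} {C : ℝ}

/-- The law of `x + t` when `x` has law `m`. -/
noncomputable def translateMeasure (m : ProbTorus d) (t : Torus d) : ProbTorus d :=
  m.map (f := fun x => x + t) (measurable_add_const t).aemeasurable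

lemma integral_translate (m : ProbTorus d) (t : Torus d) {f : Torus d → ℝ} (hf : Continuous f) :
    ∫ x, f x ∂(translateMeasure m t : Measure (Torus d)) = ∫ x, f (x + t) ∂(m : Measure (Torus d)) :=
  integral_map (measurable_add_const t).aemeasurable hf.aestronglyMeasurable

lemma integral_pi_translate (m : ProbTorus d) (z : Fin N → Torus d) {F : (Fin N → Torus d) → ℝ}
    (hF : Continuous F) :
    ∫ x, F x ∂Measure.pi (fun i => (translateMeasure m (z i) : Measure (Torus d))) =
      ∫ x, F (x + z) ∂Measure.pi fun _ => (m : Measure (Torus d)) := by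
  have e : Measure.pi (fun i => (translateMeasure m (z i) : Measure (Torus d))) =
      (Measure.pi fun _ : Fin N => (m : Measure (Torus d))).map fun x => x + z :=
    (Measure.pi_map_pi (μ := fun _ : Fin N => (m : Measure (Torus d)))
      (f := fun i x => x + z i) fun i => (measurable_add_const (z i)).aemeasurable).symm
  rw [e, integral_map (measurable_add_const z).aemeasurable hF.aestronglyMeasurable]

variable [NeZero N]

/-- The hypothesis `ε + K * dist a b` encodes a mere modulus of continuity of `U₁`, so no Hölder
exponent is needed. -/
lemma abs_averageMeasure_translate_sub_le (h₁ : IsLinearDeriv U U₁) {ε K : ℝ}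
    (hK : ∀ n a b, |U₁ n a - U₁ n b| ≤ ε + K * dist a b) (m : ProbTorus d)
    (z : Fin N → Torus d) :
    |U (averageMeasure fun i => translateMeasure m (z i)) - U m| ≤ ε + K * ((N : ℝ)⁻¹ * ∑ i, ‖z i‖) := by
  refine h₁.abs_sub_le fun n => ?_
  have hc := h₁.continuous_apply n
  have hN : (N : ℝ) ≠ 0 := Nat.cast_ne_zero.2 (NeZero.ne N)
  have e : ∫ y, U₁ n y ∂(m : Measure (Torus d)) =
      (N : ℝ)⁻¹ * ∑ _i : Fin N, ∫ y, U₁ n y ∂(m : Measure (Torus d)) := by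
    simp [hN]
  rw [integral_averageMeasure _ hc, e, ← mul_sub, ← Finset.sum_sub_distrib, abs_mul,
    abs_of_nonneg (by positivity : (0 : ℝ) ≤ (N : ℝ)⁻¹)]
  have hsum : |∑ i, (∫ y, U₁ n y ∂(translateMeasure m (z i) : Measure (Torus d)) -
      ∫ y, U₁ n y ∂(m : Measure (Torus d)))| ≤ ∑ i, (ε + K * ‖z i‖) := by
    refine (Finset.abs_sum_le_sum_abs _ _).trans (Finset.sum_le_sum fun i _ => ?_)
    rw [integral_translate _ _ hc, ← Continuous.integral_sub_of_compactSpace (by fun_prop) hc]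
    refine abs_integral_le_of_abs_le _ fun x => ?_
    simpa [dist_eq_norm] using hK n (x + z i) x
  refine (mul_le_mul_of_nonneg_left hsum (by positivity)).trans_eq ?_
  rw [Finset.sum_add_distrib, ← Finset.mul_sum, Finset.sum_const, Finset.card_univ,
    Fintype.card_fin, nsmul_eq_mul, mul_add, inv_mul_cancel_left₀ hN]
  ring

/-- For fixed `z`, the points `x i + z i` are independent with translated laws: the law of large
numbers compares with the average of these laws, the translation estimate with `m`. Integrating over
`z` turns the mean shift into the first moment of `ρ`. -/
lemma abs_smoothed_sub_le {ρ : Torus d → ℝ} (hρ : IsTrigDensity ρ) (hU : Continuous U)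
    (h₁ : IsLinearDeriv U U₁) (h₂ : ∀ a, IsLinearDeriv (fun m => U₁ m a) fun m => U₂ m a)
    (hC : ∀ n a b, |U₂ n a b| ≤ C) {ε K : ℝ}
    (hK : ∀ n a b, |U₁ n a - U₁ n b| ≤ ε + K * dist a b) (m : ProbTorus d) :
    |∫ x, ∫ z, U (empiricalMeasure (x + z)) ∂smoothingLaw N ρ
        ∂Measure.pi (fun _ : Fin N => (m : Measure (Torus d))) - U m| ≤
      (N : ℝ)⁻¹ * (4 * C) + ε + K * ∫ x, ‖x‖ * ρ x := by
  have := hρ.isProbabilityMeasure (N := N)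
  have hF : Continuous fun z : Fin N → Torus d => U (empiricalMeasure z) :=
    hU.comp continuous_empiricalMeasure
  have hF2 : Continuous fun p : (Fin N → Torus d) × (Fin N → Torus d) =>
      U (empiricalMeasure (p.2 + p.1)) := hF.comp (continuous_snd.add continuous_fst)
  have hF2' : Continuous fun p : (Fin N → Torus d) × (Fin N → Torus d) =>
      U (empiricalMeasure (p.1 + p.2)) := hF.comp (continuous_fst.add continuous_snd)
  have hN : (N : ℝ) ≠ 0 := Nat.cast_ne_zero.2 (NeZero.ne N)
  have hpt : ∀ z : Fin N → Torus d, |∫ x, U (empiricalMeasure (x + z))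
      ∂Measure.pi (fun _ : Fin N => (m : Measure (Torus d))) - U m| ≤
      (N : ℝ)⁻¹ * (4 * C) + ε + K * ((N : ℝ)⁻¹ * ∑ i, ‖z i‖) := fun z => by
    have e1 := abs_integral_empiricalMeasure_sub_le hU h₁ h₂ hC fun i => translateMeasure m (z i)
    rw [integral_pi_translate m z hF] at e1
    have e2 := abs_averageMeasure_translate_sub_le h₁ hK m z
    rw [abs_le] at *
    constructor <;> linarith
  have hcz : Continuous fun z : Fin N → Torus d => ∫ x, U (empiricalMeasure (x + z))
      ∂Measure.pi (fun _ : Fin N => (m : Measure (Torus d))) :=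
    Continuous.integral_of_compactSpace hF2
  have hcn : ∀ i : Fin N, Continuous fun z : Fin N → Torus d => ‖z i‖ := fun i => by fun_prop
  rw [integral_integral_swap hF2'.integrable_of_compactSpace]
  have e3 : ∫ z, ∫ x, U (empiricalMeasure (x + z))
      ∂Measure.pi (fun _ : Fin N => (m : Measure (Torus d))) ∂smoothingLaw N ρ - U m =
      ∫ z, (∫ x, U (empiricalMeasure (x + z))
        ∂Measure.pi (fun _ : Fin N => (m : Measure (Torus d))) - U m) ∂smoothingLaw N ρ := by
    rw [hcz.integral_sub_of_compactSpace continuous_const, integral_const, probReal_univ, one_smul]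
  have e4 : ∫ z, ((N : ℝ)⁻¹ * (4 * C) + ε + K * ((N : ℝ)⁻¹ * ∑ i, ‖z i‖)) ∂smoothingLaw N ρ =
      (N : ℝ)⁻¹ * (4 * C) + ε + K * ∫ x, ‖x‖ * ρ x := by
    rw [integral_add (integrable_const _) (Continuous.integrable_of_compactSpace (by fun_prop)),
      integral_const, probReal_univ, one_smul, integral_const_mul, integral_const_mul,
      integral_finsetSum _ fun i _ => (hcn i).integrable_of_compactSpace]
    simp_rw [hρ.integral_comp_apply (fun x => ‖x‖)]
    rw [Finset.sum_const, Finset.card_univ, Fintype.card_fin, nsmul_eq_mul,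
      inv_mul_cancel_left₀ hN]
  rw [e3, ← e4]
  refine (abs_integral_le_integral_abs).trans (integral_mono ?_ ?_ hpt)
  · exact Continuous.integrable_of_compactSpace (hcz.sub continuous_const).abs
  · exact Continuous.integrable_of_compactSpace (by fun_prop)

end Approximation

/-! ### The approximation theorem -/

theorem theoremA1 (d : ℕ) (α : ℝ) (hα0 : 0 ≤ α) (hα1 : α < 1) (Φ : ProbTorus d → ℝ)
    (hΦ : IntPhi α 2 Φ) :
    ∃ Φn : ℕ → ProbTorus d → ℝ,
      (∀ n, SmoothFunctional (Φn n) ∧ IntPhi 4 3 (Φn n)) ∧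
      TendstoUniformly Φn Φ atTop ∧
      ∃ C : ℝ, ∀ n, IntPhiBound α 2 C (Φn n) := by
  obtain ⟨C, V, hV, hD⟩ := hΦ
  have hfl : ⌊α⌋₊ = 0 := Nat.floor_eq_zero.2 hα1
  rw [hfl, Nat.cast_zero, sub_zero] at hD
  have hVb : ∀ ℓ ≤ 2, (∀ m y, |V ℓ m y| ≤ C) ∧ UniformEquicontinuous (V ℓ) ∧
      (0 < α → ∀ m y z, |V ℓ m y - V ℓ m z| ≤ C * dist y z ^ α) := fun ℓ hℓ => by
    obtain ⟨D, h1, h2⟩ := hD ℓ hℓ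
    have e : D 0 = V ℓ := funext fun m => (h1 m).zero
    rw [← e]
    exact h2 0 fun i => by simp
  -- Tuples are built by `Fin.snoc` so that the identities of `IsFlatDeriv` apply verbatim.
  let c₁ : Torus d → Fin 1 → Torus d := fun a => Fin.snoc (Fin.elim0 : Fin 0 → Torus d) a
  let c₂ : Torus d → Torus d → Fin 2 → Torus d := fun a b => Fin.snoc (c₁ a) b
  have hc₁ : Continuous c₁ := continuous_const.finSnoc continuous_id
  have hc₂ : ∀ a, Continuous (c₂ a) := fun a => continuous_const.finSnoc continuous_id
  have hdist₁ : ∀ a a', dist (c₁ a) (c₁ a') ≤ dist a a' := fun a a' => by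
    refine (dist_pi_le_iff dist_nonneg).2 fun i => ?_
    fin_cases i
    exact le_rfl
  have hdist₂ : ∀ a a' b, dist (c₂ a b) (c₂ a' b) ≤ dist a a' := fun a a' b => by
    refine (dist_pi_le_iff dist_nonneg).2 fun i => ?_
    refine Fin.lastCases ?_ (fun i => ?_) i
    · simp only [c₂, Fin.snoc_last, dist_self]
      exact dist_nonneg
    · simpa only [c₂, Fin.snoc_castSucc] using (dist_le_pi_dist (c₁ a) (c₁ a') i).trans (hdist₁ a a')
  let U₁ : ProbTorus d → Torus d → ℝ := fun m a => V 1 m (c₁ a)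
  let U₂ : ProbTorus d → Torus d → Torus d → ℝ := fun m a b => V 2 m (c₂ a b)
  have hΦc : Continuous Φ := by
    have h := (hV.continuous 0 (by norm_num)).comp
      (Continuous.prodMk_left (X := ProbTorus d) (Fin.elim0 : Fin 0 → Torus d))
    exact h.congr fun m => hV.zero m _
  have h₁ : IsLinearDeriv Φ U₁ :=
    ⟨(hV.continuous 1 (by norm_num)).comp (continuous_fst.prodMk (hc₁.comp continuous_snd)),
      fun m m' => by
        have h := hV.sub_eq_integral 0 (by norm_num) m m' Fin.elim0
        rwa [hV.zero, hV.zero] at h⟩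
  have h₂ : ∀ a, IsLinearDeriv (fun m => U₁ m a) fun m => U₂ m a := fun a =>
    ⟨(hV.continuous 2 le_rfl).comp (continuous_fst.prodMk ((hc₂ a).comp continuous_snd)),
      fun m m' => hV.sub_eq_integral 1 (by norm_num) m m' (c₁ a)⟩
  obtain ⟨x₀⟩ : Nonempty (Torus d) := inferInstance
  have hC0 : 0 ≤ C := (abs_nonneg _).trans ((hVb 1 (by norm_num)).1 (diracProba x₀) (c₁ x₀))
  have hC₂ : ∀ n a b, |U₂ n a b| ≤ C := fun n a b => (hVb 2 le_rfl).1 n _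
  -- Two weights free of `N` are used: the constant `2 * C` yields the sup bounds, `C * dist a a' ^
  -- α` the Hölder bounds.
  have hw : ∀ N [NeZero N], HasDiffBound (fun z : Fin N → Torus d => Φ (empiricalMeasure z))
      fun _ _ => 2 * C := fun N _ =>
    hasDiffBound_empiricalMeasure h₁ h₂
      (fun n a a' => (abs_sub _ _).trans (by
        linarith [(hVb 1 (by norm_num)).1 n (c₁ a), (hVb 1 (by norm_num)).1 n (c₁ a')]))
      (fun n a a' b => (abs_sub _ _).trans (by linarith [hC₂ n a b, hC₂ n a' b]))
  have hw' : ∀ N [NeZero N], 0 < α → HasDiffBound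
      (fun z : Fin N → Torus d => Φ (empiricalMeasure z)) fun a a' => C * dist a a' ^ α :=
    fun N _ h0 => hasDiffBound_empiricalMeasure h₁ h₂
      (fun n a a' => ((hVb 1 (by norm_num)).2.2 h0 n _ _).trans (by
        gcongr
        exact hdist₁ a a'))
      (fun n a a' b => ((hVb 2 le_rfl).2.2 h0 n _ _).trans (by
        gcongr
        exact hdist₂ a a' b))
  obtain ⟨ρ, hρ, hρ0⟩ := exists_isTrigDensity_tendsto d
  have hFc : ∀ N [NeZero N], Continuous fun z : Fin N → Torus d => Φ (empiricalMeasure z) :=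
    fun N _ => hΦc.comp continuous_empiricalMeasure
  let H : (n : ℕ) → (Fin (n + 1) → Torus d) → ℝ := fun n x =>
    ∫ z, Φ (empiricalMeasure (x + z)) ∂smoothingLaw (n + 1) (ρ n)
  have hH : ∀ n, IsTrigPolynomial d (n + 1) (H n) := fun n =>
    (hρ n).isTrigPolynomial_integral (hFc (n + 1))
  have hsmooth := fun n => smoothFunctional_integral_pi (hH n)
  refine ⟨fun n m => ∫ x, H n x ∂Measure.pi fun _ => (m : Measure (Torus d)),
    fun n => ⟨hsmooth n, ?_⟩, ?_, 10 * C, fun n => ?_⟩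
  · simpa using hsmooth n 4 3
  · rw [Metric.tendstoUniformly_iff]
    intro ε hε
    obtain ⟨δ, hδ, hδ'⟩ := Metric.uniformEquicontinuous_iff.1 (hVb 1 (by norm_num)).2.1
      (ε / 2) (by positivity)
    -- Equicontinuity handles distances below `δ`; beyond `δ` the bound `2C` is absorbed by the
    -- linear term. This covers `α = 0` as well.
    have hK : ∀ n a b, |U₁ n a - U₁ n b| ≤ ε / 2 + 2 * C / δ * dist a b := fun n a b => by
      rcases lt_or_ge (dist a b) δ with h | h
      · have e := hδ' (c₁ a) (c₁ b) ((hdist₁ a b).trans_lt h) n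
        rw [Real.dist_eq] at e
        exact e.le.trans (le_add_of_nonneg_right (by positivity))
      · have e : 2 * C ≤ 2 * C / δ * dist a b := by
          rw [div_mul_eq_mul_div, le_div_iff₀ hδ]
          gcongr
        refine (abs_sub _ _).trans ?_
        linarith [(hVb 1 (by norm_num)).1 n (c₁ a), (hVb 1 (by norm_num)).1 n (c₁ b)]
    have hlim : Tendsto (fun n : ℕ => ((n + 1 : ℕ) : ℝ)⁻¹ * (4 * C) + ε / 2 +
        2 * C / δ * ∫ x, ‖x‖ * ρ n x) atTop (𝓝 (0 * (4 * C) + ε / 2 + 2 * C / δ * 0)) :=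
      (((tendsto_inv_atTop_zero.comp tendsto_natCast_atTop_atTop).comp
        (tendsto_add_atTop_nat 1)).mul_const _ |>.add_const _).add (hρ0.const_mul _)
    filter_upwards [hlim.eventually_lt_const (show _ < ε by linarith)] with n hn m
    rw [dist_comm, Real.dist_eq]
    exact (abs_smoothed_sub_le (hρ n) hΦc h₁ h₂ hC₂ hK m).trans_lt hn
  · have := (hρ n).isProbabilityMeasure (N := n + 1)
    refine intPhiBound_of_hasDiffBound (hH n) hα1 hC0 (fun x => ?_) ?_ fun h0 => ?_
    · refine abs_integral_le_of_abs_le _ fun z => ?_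
      rw [← hV.zero _ Fin.elim0]
      exact (hVb 0 (by norm_num)).1 _ _
    · exact (hw (n + 1)).integral_add (hFc _) (fun _ _ _ => rfl) _
    · exact (hw' (n + 1) h0).integral_add (hFc _) (fun a a' c => by rw [dist_add_right]) _
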